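/- Let $G$ be a finite-dimensional (real, smooth) Lie group with a left-invariant Riemannian metric, i.e. one for which all left translations are isometries. Say that a Riemannian manifold $M$ has dense closed geodesics if for every $p\in M$, every unit vector $v\in T_pM$ and every $\varepsilon>0$ there is a vector $w\in T_pM$ with $|v-w|<\varepsilon$ such that the geodesic $\gamma(t)=\exp_p(tw)$ is closed, meaning that $\gamma(\tau)=p$ for some $\tau>0$. If $G$ has dense closed geodesics, then either there is a $2$-plane in $T_{\mathrm{id}}G$ whose sectional curvature is positive, or the metric is flat and the identity component of $G$ is abelian; in particular, in the latter case, $G$ is itself abelian if it is connected. -/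

import Mathlib

open Bundle VectorField
open scoped Manifold ContDiff Topology

noncomputable section

namespace RiemannianGeometry

/-! ### The Levi-Civita connection of a Riemannian manifold -/

section LeviCivita

variable {E : Type*} [NormedAddCommGroup E] [NormedSpace ℝ E]
  {H : Type*} [TopologicalSpace H] {I : ModelWithCorners ℝ E H}
  {M : Type*} [TopologicalSpace M] [ChartedSpace H M]
  [RiemannianBundle (fun x : M ↦ TangentSpace I x)]

/-- The differential at `x` of the function `⟨X, Y⟩`. -/
def dInner (X Y : Π x : M, TangentSpace I x) (x : M) : TangentSpace I x →L[ℝ] ℝ :=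
  mvfderiv I (fun y ↦ inner ℝ (X y) (Y y)) x

/-- The right-hand side of the Koszul formula for `2 ⟨∇_X Y, Z⟩` at `x`:
`X⟨Y, Z⟩ + Y⟨X, Z⟩ - Z⟨X, Y⟩ + ⟨[X, Y], Z⟩ - ⟨[Y, Z], X⟩ - ⟨[X, Z], Y⟩`. -/
def koszul (X Y Z : Π x : M, TangentSpace I x) (x : M) : ℝ :=
  dInner Y Z x (X x) + dInner X Z x (Y x) - dInner X Y x (Z x)
    + inner ℝ (mlieBracket I X Y x) (Z x)
    - inner ℝ (mlieBracket I Y Z x) (X x)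
    - inner ℝ (mlieBracket I X Z x) (Y x)

lemma dInner_comm (X Y : Π x : M, TangentSpace I x) (x : M) :
    dInner X Y x = dInner Y X x := by
  simp only [dInner, real_inner_comm]

variable [IsManifold I ∞ M] [IsContMDiffRiemannianBundle I ∞ E (fun x : M ↦ TangentSpace I x)]

lemma mdifferentiableAt_inner {X Y : Π x : M, TangentSpace I x} {x : M}
    (hX : MDiffAt (T% X) x) (hY : MDiffAt (T% Y) x) :
    MDiffAt (fun y ↦ inner ℝ (X y) (Y y)) x :=
  MDifferentiableAt.inner_bundle (IB := I) (F := E) (E := fun x : M ↦ TangentSpace I x)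
    (b := fun y ↦ y) (v := X) (w := Y) hX hY

lemma dInner_smul_left {X Y : Π x : M, TangentSpace I x} {f : M → ℝ} {x : M} (hf : MDiffAt f x)
    (hX : MDiffAt (T% X) x) (hY : MDiffAt (T% Y) x) (v : TangentSpace I x) :
    dInner (f • X) Y x v = f x * dInner X Y x v + mvfderiv I f x v * inner ℝ (X x) (Y x) := by
  have h := mvfderiv_fun_mul hf (mdifferentiableAt_inner hX hY)
  simp only [dInner, Pi.smul_apply', real_inner_smul_left]
  rw [h]
  simp
  ring

lemma dInner_smul_right {X Y : Π x : M, TangentSpace I x} {f : M → ℝ} {x : M} (hf : MDiffAt f x)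
    (hX : MDiffAt (T% X) x) (hY : MDiffAt (T% Y) x) (v : TangentSpace I x) :
    dInner X (f • Y) x v = f x * dInner X Y x v + mvfderiv I f x v * inner ℝ (X x) (Y x) := by
  rw [dInner_comm, dInner_smul_left hf hY hX, dInner_comm Y X, real_inner_comm]

lemma dInner_add_left {X X' Y : Π x : M, TangentSpace I x} {x : M}
    (hX : MDiffAt (T% X) x) (hX' : MDiffAt (T% X') x) (hY : MDiffAt (T% Y) x) :
    dInner (X + X') Y x = dInner X Y x + dInner X' Y x := by
  simp only [dInner, Pi.add_apply, inner_add_left]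
  exact mvfderiv_fun_add (mdifferentiableAt_inner hX hY) (mdifferentiableAt_inner hX' hY)

lemma dInner_add_right {X Y Y' : Π x : M, TangentSpace I x} {x : M}
    (hX : MDiffAt (T% X) x) (hY : MDiffAt (T% Y) x) (hY' : MDiffAt (T% Y') x) :
    dInner X (Y + Y') x = dInner X Y x + dInner X Y' x := by
  rw [dInner_comm, dInner_add_left hY hY' hX, dInner_comm Y X, dInner_comm Y' X]

variable [FiniteDimensional ℝ E]

instance finiteDimensional_tangentSpace (x : M) : FiniteDimensional ℝ (TangentSpace I x) :=
  inferInstanceAs (FiniteDimensional ℝ E)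

lemma koszul_smul_left {f : M → ℝ} {X Y Z : Π x : M, TangentSpace I x} {x : M} (hf : MDiffAt f x)
    (hX : MDiffAt (T% X) x) (hY : MDiffAt (T% Y) x) (hZ : MDiffAt (T% Z) x) :
    koszul (f • X) Y Z x = f x * koszul X Y Z x := by
  simp only [koszul, dInner_smul_left hf hX hY, dInner_smul_left hf hX hZ,
    mlieBracket_smul_left hf hX, Pi.smul_apply', inner_add_left, real_inner_smul_left,
    real_inner_smul_right, map_smul, smul_eq_mul]
  ring

lemma koszul_add_left {X X' Y Z : Π x : M, TangentSpace I x} {x : M}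
    (hX : MDiffAt (T% X) x) (hX' : MDiffAt (T% X') x) (hY : MDiffAt (T% Y) x)
    (hZ : MDiffAt (T% Z) x) :
    koszul (X + X') Y Z x = koszul X Y Z x + koszul X' Y Z x := by
  simp only [koszul, dInner_add_left hX hX' hY, dInner_add_left hX hX' hZ,
    mlieBracket_add_left hX hX', Pi.add_apply, inner_add_left, inner_add_right, map_add,
    add_apply]
  ring

lemma koszul_smul_right {f : M → ℝ} {X Y Z : Π x : M, TangentSpace I x} {x : M}
    (hf : MDiffAt f x) (hX : MDiffAt (T% X) x) (hY : MDiffAt (T% Y) x) (hZ : MDiffAt (T% Z) x) :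
    koszul X Y (f • Z) x = f x * koszul X Y Z x := by
  simp only [koszul, dInner_smul_right hf hY hZ, dInner_smul_right hf hX hZ,
    mlieBracket_smul_right hf hZ, Pi.smul_apply', inner_add_left, real_inner_smul_left,
    real_inner_smul_right, map_smul, smul_eq_mul]
  rw [real_inner_comm (Y x) (Z x), real_inner_comm (X x) (Z x)]
  ring

lemma koszul_add_right {X Y Z Z' : Π x : M, TangentSpace I x} {x : M}
    (hX : MDiffAt (T% X) x) (hY : MDiffAt (T% Y) x) (hZ : MDiffAt (T% Z) x)
    (hZ' : MDiffAt (T% Z') x) :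
    koszul X Y (Z + Z') x = koszul X Y Z x + koszul X Y Z' x := by
  simp only [koszul, dInner_add_right hX hZ hZ', dInner_add_right hY hZ hZ',
    mlieBracket_add_right hZ hZ', Pi.add_apply, inner_add_left, inner_add_right, map_add,
    add_apply]
  ring

lemma koszul_smul_mid {f : M → ℝ} {X Y Z : Π x : M, TangentSpace I x} {x : M} (hf : MDiffAt f x)
    (hX : MDiffAt (T% X) x) (hY : MDiffAt (T% Y) x) (hZ : MDiffAt (T% Z) x) :
    koszul X (f • Y) Z x =
      f x * koszul X Y Z x + 2 * (mvfderiv I f x (X x) * inner ℝ (Y x) (Z x)) := by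
  simp only [koszul, dInner_smul_left hf hY hZ, dInner_smul_right hf hX hY,
    mlieBracket_smul_right hf hY, mlieBracket_smul_left hf hY, Pi.smul_apply', inner_add_left,
    real_inner_smul_left, real_inner_smul_right, map_smul, smul_eq_mul]
  rw [real_inner_comm (X x) (Y x)]
  ring

lemma koszul_add_mid {X Y Y' Z : Π x : M, TangentSpace I x} {x : M}
    (hX : MDiffAt (T% X) x) (hY : MDiffAt (T% Y) x) (hY' : MDiffAt (T% Y') x)
    (hZ : MDiffAt (T% Z) x) :
    koszul X (Y + Y') Z x = koszul X Y Z x + koszul X Y' Z x := by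
  simp only [koszul, dInner_add_left hY hY' hZ, dInner_add_right hX hY hY',
    mlieBracket_add_right hY hY', mlieBracket_add_left hY hY', Pi.add_apply, inner_add_left,
    inner_add_right, map_add, add_apply]
  ring

/-- For `Y` differentiable at `x`, the bilinear form on `T_x M` sending `(X x, Z x)` to
`koszul X Y Z x`. -/
def koszulForm (Y : Π x : M, TangentSpace I x) (x : M) (hY : MDiffAt (T% Y) x) :
    TangentSpace I x →L[ℝ] TangentSpace I x →L[ℝ] ℝ :=
  TensorialAt.mkHom₂ (I := I) (F := E) (F' := E) (V := fun x : M ↦ TangentSpace I x)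
    (V' := fun x : M ↦ TangentSpace I x)
    (fun X Z ↦ koszul X Y Z x) x
    (fun _ hZ ↦ ⟨fun hf hX ↦ koszul_smul_left hf hX hY hZ,
      fun hX hX' ↦ koszul_add_left hX hX' hY hZ⟩)
    (fun _ hX ↦ ⟨fun hf hZ ↦ koszul_smul_right hf hX hY hZ,
      fun hZ hZ' ↦ koszul_add_right hX hY hZ hZ'⟩)

lemma koszulForm_apply {X Y Z : Π x : M, TangentSpace I x} {x : M} (hX : MDiffAt (T% X) x)
    (hY : MDiffAt (T% Y) x) (hZ : MDiffAt (T% Z) x) :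
    koszulForm Y x hY (X x) (Z x) = koszul X Y Z x :=
  TensorialAt.mkHom₂_apply _ _ hX hZ

open Classical in
/-- `leviCivitaFun Y x v` is `∇_v Y`: the vector dual to half of the Koszul form of `Y`
(and `0` by convention when `Y` is not differentiable at `x`). -/
def leviCivitaFun (Y : Π x : M, TangentSpace I x) (x : M) :
    TangentSpace I x →L[ℝ] TangentSpace I x :=
  if hY : MDiffAt (T% Y) x then
    LinearMap.toContinuousLinearMap
      { toFun := fun v ↦ (1 / 2 : ℝ) •
          (InnerProductSpace.toDual ℝ (TangentSpace I x)).symm (koszulForm Y x hY v)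
        map_add' := fun v w ↦ by rw [map_add, map_add, smul_add]
        map_smul' := fun c v ↦ by
          rw [map_smul, LinearIsometryEquiv.map_smulₛₗ, smul_comm]; rfl }
  else 0

lemma inner_leviCivitaFun {X Y Z : Π x : M, TangentSpace I x} {x : M} (hX : MDiffAt (T% X) x)
    (hY : MDiffAt (T% Y) x) (hZ : MDiffAt (T% Z) x) :
    inner ℝ (leviCivitaFun Y x (X x)) (Z x) = (1 / 2 : ℝ) * koszul X Y Z x := by
  rw [← koszulForm_apply hX hY hZ, leviCivitaFun, dif_pos hY]
  refine (real_inner_smul_left _ _ _).trans ?_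
  congr 1
  exact InnerProductSpace.toDual_symm_apply

lemma clm_ext_of_fields {x : M} {A B : TangentSpace I x →L[ℝ] TangentSpace I x}
    (h : ∀ X Z : Π x : M, TangentSpace I x, MDiffAt (T% X) x → MDiffAt (T% Z) x →
      inner ℝ (A (X x)) (Z x) = inner ℝ (B (X x)) (Z x)) : A = B := by
  ext v
  refine ext_inner_right ℝ fun w ↦ ?_
  have := h (FiberBundle.extend E v) (FiberBundle.extend E w)
    (FiberBundle.mdifferentiableAt_extend ..) (FiberBundle.mdifferentiableAt_extend ..)
  simpa using this

/-- The Levi-Civita connection of a Riemannian manifold, given by the Koszul formula.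
`leviCivita Y x v` is `∇_v Y` at `x`. -/
def leviCivita : CovariantDerivative I E (fun x : M ↦ TangentSpace I x) where
  toFun := leviCivitaFun
  isCovariantDerivativeOnUniv :=
    { add := fun {Y Y' x} hY hY' _ ↦ clm_ext_of_fields fun X Z hX hZ ↦ by
        rw [inner_leviCivitaFun hX (mdifferentiableAt_add_section hY hY') hZ,
          koszul_add_mid hX hY hY' hZ, add_apply, inner_add_left, inner_leviCivitaFun hX hY hZ,
          inner_leviCivitaFun hX hY' hZ]
        ring
      leibniz := fun {Y f x} hY hf _ ↦ clm_ext_of_fields fun X Z hX hZ ↦ by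
        rw [inner_leviCivitaFun hX (hf.smul_section hY) hZ, koszul_smul_mid hf hX hY hZ,
          add_apply, inner_add_left, smul_apply, real_inner_smul_left,
          ContinuousLinearMap.smulRight_apply, real_inner_smul_left,
          inner_leviCivitaFun hX hY hZ]
        ring }

/-- The Koszul formula. -/
theorem inner_leviCivita {X Y Z : Π x : M, TangentSpace I x} {x : M} (hX : MDiffAt (T% X) x)
    (hY : MDiffAt (T% Y) x) (hZ : MDiffAt (T% Z) x) :
    inner ℝ (leviCivita Y x (X x)) (Z x) = (1 / 2 : ℝ) * koszul X Y Z x :=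
  inner_leviCivitaFun hX hY hZ

/-- The Levi-Civita connection is torsion-free. -/
theorem torsion_leviCivita :
    (leviCivita : CovariantDerivative I E (fun x : M ↦ TangentSpace I x)).torsion = 0 := by
  rw [CovariantDerivative.torsion_eq_zero_iff]
  intro X Y x hX hY
  refine ext_inner_right ℝ fun w ↦ ?_
  have hZ := FiberBundle.mdifferentiableAt_extend I E w
  have h1 := inner_leviCivita hX hY hZ
  have h2 := inner_leviCivita hY hX hZ
  have h3 : koszul X Y (FiberBundle.extend E w) x - koszul Y X (FiberBundle.extend E w) x =
      2 * inner ℝ (mlieBracket I X Y x) w := by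
    rw [koszul, koszul, dInner_comm Y X, mlieBracket_swap_apply (V := Y) (W := X)]
    simp only [FiberBundle.extend_apply_self, inner_neg_left]
    ring
  simp only [FiberBundle.extend_apply_self] at h1 h2
  rw [inner_sub_left, h1, h2]
  linarith

/-- The Levi-Civita connection is compatible with the metric. -/
theorem isMetricCompatible_leviCivita {X Y Z : Π x : M, TangentSpace I x} {x : M}
    (hX : MDiffAt (T% X) x) (hY : MDiffAt (T% Y) x) (hZ : MDiffAt (T% Z) x) :
    mvfderiv I (fun y ↦ inner ℝ (Y y) (Z y)) x (X x) =
      inner ℝ (leviCivita Y x (X x)) (Z x) + inner ℝ (Y x) (leviCivita Z x (X x)) := by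
  change dInner Y Z x (X x) = _
  rw [real_inner_comm (leviCivita Z x (X x)) (Y x), inner_leviCivita hX hY hZ,
    inner_leviCivita hX hZ hY, koszul, koszul, dInner_comm Z Y,
    mlieBracket_swap_apply (V := Z) (W := Y)]
  simp only [inner_neg_left]
  ring

end LeviCivita

/-! ### Geodesics and curvature -/

section Geometry

variable {E : Type*} [NormedAddCommGroup E] [NormedSpace ℝ E] [FiniteDimensional ℝ E]
  {H : Type*} [TopologicalSpace H] (I : ModelWithCorners ℝ E H)
  {M : Type*} [TopologicalSpace M] [ChartedSpace H M] [IsManifold I ∞ M]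
  [RiemannianBundle (fun x : M ↦ TangentSpace I x)]
  [IsContMDiffRiemannianBundle I ∞ E (fun x : M ↦ TangentSpace I x)]

/-- The velocity `γ'(t)` of a curve. -/
def velocity (γ : ℝ → M) (t : ℝ) : TangentSpace I (γ t) :=
  mfderiv 𝓘(ℝ, ℝ) I γ t (1 : ℝ)

/-- `W` is the covariant derivative `DV/dt` at `t₀` of the vector field `V` along the curve `γ`:
if `V t = ∑ i, f i t • X i (γ t)` for `t` near `t₀`, with functions `f i` differentiable at `t₀` and
vector fields `X i` on `M` differentiable at `γ t₀`, then
`DV/dt = ∑ i, (f i)' • X i + f i • ∇_{γ'} (X i)`, whatever the representation of `V`. -/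
def HasCovDerivAlong (γ : ℝ → M) (V : Π t : ℝ, TangentSpace I (γ t)) (t₀ : ℝ)
    (W : TangentSpace I (γ t₀)) : Prop :=
  MDifferentiableAt 𝓘(ℝ, ℝ) I γ t₀ ∧
  ∃ (n : ℕ) (f : Fin n → ℝ → ℝ) (f' : Fin n → ℝ) (X : Fin n → Π x : M, TangentSpace I x),
    (∀ i, HasDerivAt (f i) (f' i) t₀) ∧
    (∀ i, MDiffAt (T% (X i)) (γ t₀)) ∧
    (∀ᶠ t in 𝓝 t₀, V t = ∑ i, f i t • X i (γ t)) ∧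
    W = ∑ i, (f' i • X i (γ t₀) + f i t₀ • leviCivita (X i) (γ t₀) (velocity I γ t₀))

/-- `γ` is a geodesic on the open set of times `s`: it is smooth and `Dγ'/dt = 0` there. -/
def IsGeodesicOn (γ : ℝ → M) (s : Set ℝ) : Prop :=
  ContMDiffOn 𝓘(ℝ, ℝ) I ∞ γ s ∧ ∀ t ∈ s, HasCovDerivAlong I γ (velocity I γ) t 0

/-- The geodesic `t ↦ exp_p (t w)` returns to `p` at some time `τ > 0`. -/
def IsClosedDirection (p : M) (w : TangentSpace I p) : Prop :=
  ∃ (γ : ℝ → M) (s : Set ℝ) (τ : ℝ), 0 < τ ∧ IsOpen s ∧ Set.Icc 0 τ ⊆ s ∧ IsGeodesicOn I γ s ∧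
    (⟨γ 0, velocity I γ 0⟩ : TangentBundle I M) = ⟨p, w⟩ ∧ γ τ = p

variable (M) in
/-- Dense closed geodesics: every unit tangent vector is a limit of initial velocities (at the same
base point) of closed geodesics. The norm is the Riemannian one. -/
def HasDenseClosedGeodesics : Prop :=
  ∀ (p : M) (v : TangentSpace I p), ‖v‖ = 1 → ∀ ε > (0 : ℝ),
    ∃ w : TangentSpace I p, ‖v - w‖ < ε ∧ IsClosedDirection I p w

/-- The curvature `R(X, Y)Z = ∇_X ∇_Y Z - ∇_Y ∇_X Z - ∇_{[X, Y]} Z`. -/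
def curvature (X Y Z : Π x : M, TangentSpace I x) (x : M) : TangentSpace I x :=
  leviCivita (fun y ↦ leviCivita Z y (Y y)) x (X x)
    - leviCivita (fun y ↦ leviCivita Z y (X y)) x (Y x)
    - leviCivita Z x (mlieBracket I X Y x)

/-- The sectional curvature of the plane spanned by `X x` and `Y x` (for smooth vector fields that
are linearly independent at `x`). -/
def sectionalCurvature (X Y : Π x : M, TangentSpace I x) (x : M) : ℝ :=
  inner ℝ (curvature I X Y Y x) (X x) /
    (‖X x‖ ^ 2 * ‖Y x‖ ^ 2 - (inner ℝ (X x) (Y x)) ^ 2)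

variable (M) in
/-- The metric is flat: its curvature tensor vanishes. -/
def IsFlat : Prop :=
  ∀ X Y Z : Π x : M, TangentSpace I x, CMDiff ∞ (T% X) → CMDiff ∞ (T% Y) → CMDiff ∞ (T% Z) →
    ∀ x : M, curvature I X Y Z x = 0

end Geometry

/-! ### Left-invariant metrics on Lie groups -/

section LieGroup

variable {E : Type*} [NormedAddCommGroup E] [NormedSpace ℝ E]
  {H : Type*} [TopologicalSpace H] (I : ModelWithCorners ℝ E H)
  (G : Type*) [TopologicalSpace G] [ChartedSpace H G] [Group G]
  [RiemannianBundle (fun x : G ↦ TangentSpace I x)]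

/-- All left translations are isometries of the Riemannian metric. -/
def IsLeftInvariantMetric : Prop :=
  ∀ (g h : G) (v w : TangentSpace I h),
    (inner ℝ (mfderiv I I (fun x : G ↦ g * x) h v : TangentSpace I (g * h))
      (mfderiv I I (fun x : G ↦ g * x) h w : TangentSpace I (g * h)) : ℝ) = inner ℝ v w

variable {G} [FiniteDimensional ℝ E] [IsManifold I ∞ G]
  [IsContMDiffRiemannianBundle I ∞ E (fun x : G ↦ TangentSpace I x)]

/-- The sectional curvature at the identity of the plane spanned by `u` and `v`, computed with
the left-invariant vector fields extending `u` and `v`. -/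
def sectionalCurvatureAtOne (u v : GroupLieAlgebra I G) : ℝ :=
  sectionalCurvature I (mulInvariantVectorField u) (mulInvariantVectorField v) (1 : G)

end LieGroup

end RiemannianGeometry

end

noncomputable section

namespace RiemannianGeometry

section BracketOnFunctions

variable {E : Type*} [NormedAddCommGroup E] [NormedSpace ℝ E]
  {M : Type*} [TopologicalSpace M] [ChartedSpace E M]

lemma comp_extChartAt_symm_comp_extChartAt_eventuallyEq {α : Type*} (k : M → α) {x y : M}
    (hy : y ∈ (extChartAt 𝓘(ℝ, E) x).source) :
    (k ∘ (extChartAt 𝓘(ℝ, E) x).symm) ∘ extChartAt 𝓘(ℝ, E) x =ᶠ[𝓝 y] k := by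
  filter_upwards [extChartAt_source_mem_nhds' hy] with z hz
  exact congrArg k ((extChartAt 𝓘(ℝ, E) x).left_inv hz)

section

variable [IsManifold 𝓘(ℝ, E) 1 M]

lemma mdifferentiableAt_comp_extChartAt_symm {k : M → ℝ} {x y : M}
    (hy : y ∈ (extChartAt 𝓘(ℝ, E) x).source) (hk : MDiffAt k y) :
    MDifferentiableAt 𝓘(ℝ, E) 𝓘(ℝ, ℝ) (k ∘ (extChartAt 𝓘(ℝ, E) x).symm)
      (extChartAt 𝓘(ℝ, E) x y) := by
  have h1 : MDifferentiableAt 𝓘(ℝ, E) 𝓘(ℝ, E) (extChartAt 𝓘(ℝ, E) x).symm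
      (extChartAt 𝓘(ℝ, E) x y) := by
    have := mdifferentiableWithinAt_extChartAt_symm (I := 𝓘(ℝ, E))
      ((extChartAt 𝓘(ℝ, E) x).map_source hy)
    simpa [mdifferentiableWithinAt_univ] using this
  refine MDifferentiableAt.comp _ ?_ h1
  rwa [(extChartAt 𝓘(ℝ, E) x).left_inv hy]

lemma mvfderiv_eq_fderiv_comp_extChartAt_symm {k : M → ℝ} {x y : M}
    (hy : y ∈ (extChartAt 𝓘(ℝ, E) x).source) (hk : MDiffAt k y) (v : TangentSpace 𝓘(ℝ, E) y) :
    mvfderiv 𝓘(ℝ, E) k y v = fderiv ℝ (k ∘ (extChartAt 𝓘(ℝ, E) x).symm)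
      (extChartAt 𝓘(ℝ, E) x y) (mfderiv 𝓘(ℝ, E) 𝓘(ℝ, E) (extChartAt 𝓘(ℝ, E) x) y v) := by
  have h2 := mdifferentiableAt_comp_extChartAt_symm hy hk
  have h3 : MDifferentiableAt 𝓘(ℝ, E) 𝓘(ℝ, E) (extChartAt 𝓘(ℝ, E) x) y :=
    mdifferentiableAt_extChartAt (by simpa using hy)
  have h4 := mfderiv_comp_apply y h2 h3 v
  rw [(comp_extChartAt_symm_comp_extChartAt_eventuallyEq k hy).mfderiv_eq] at h4
  rw [mfderiv_eq_fderiv] at h4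
  exact h4

lemma mpullbackWithin_extChartAt_symm_apply (V : Π x : M, TangentSpace 𝓘(ℝ, E) x) {x y : M}
    (hy : y ∈ (extChartAt 𝓘(ℝ, E) x).source) :
    mpullbackWithin 𝓘(ℝ, E) 𝓘(ℝ, E) (extChartAt 𝓘(ℝ, E) x).symm V (Set.range 𝓘(ℝ, E))
      (extChartAt 𝓘(ℝ, E) x y) = mfderiv 𝓘(ℝ, E) 𝓘(ℝ, E) (extChartAt 𝓘(ℝ, E) x) y (V y) := by
  rw [mpullbackWithin_apply]
  have h1 := mfderivWithin_extChartAt_symm_comp_mfderiv_extChartAt' (I := 𝓘(ℝ, E)) hy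
  have h2 := mfderiv_extChartAt_comp_mfderivWithin_extChartAt_symm' (I := 𝓘(ℝ, E)) hy
  have h3 : ∀ z, z = y → mfderiv 𝓘(ℝ, E) 𝓘(ℝ, E) (extChartAt 𝓘(ℝ, E) x) y (V z) =
      mfderiv 𝓘(ℝ, E) 𝓘(ℝ, E) (extChartAt 𝓘(ℝ, E) x) y (V y) := by rintro z rfl; rfl
  refine Eq.trans ?_ (h3 _ ((extChartAt 𝓘(ℝ, E) x).left_inv hy))
  exact congrArg (fun A : E →L[ℝ] E ↦ A (V _)) (ContinuousLinearMap.inverse_eq h1 h2)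

end

variable [IsManifold 𝓘(ℝ, E) ∞ M]

omit [IsManifold 𝓘(ℝ, E) ∞ M] in
lemma contDiffAt_comp_extChartAt_symm {f : M → ℝ} {x : M} {n : WithTop ℕ∞}
    (hf : CMDiffAt n f x) :
    ContDiffAt ℝ n (f ∘ (extChartAt 𝓘(ℝ, E) x).symm) (extChartAt 𝓘(ℝ, E) x x) := by
  have := (contMDiffAt_iff.1 hf).2
  rw [ModelWithCorners.range_eq_univ, contDiffWithinAt_univ] at this
  exact this

lemma mvfderiv_apply_comp_extChartAt_symm_eventuallyEq {f : M → ℝ} {x : M} (hf : CMDiffAt 2 f x)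
    (V : Π x : M, TangentSpace 𝓘(ℝ, E) x) :
    (fun y ↦ mvfderiv 𝓘(ℝ, E) f y (V y)) ∘ (extChartAt 𝓘(ℝ, E) x).symm
      =ᶠ[𝓝 (extChartAt 𝓘(ℝ, E) x x)]
    fun a ↦ fderiv ℝ (f ∘ (extChartAt 𝓘(ℝ, E) x).symm) a
      (mpullbackWithin 𝓘(ℝ, E) 𝓘(ℝ, E) (extChartAt 𝓘(ℝ, E) x).symm V
        (Set.range 𝓘(ℝ, E)) a) := by
  have hd : ∀ᶠ y in 𝓝 x, MDiffAt f y := by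
    have : IsManifold 𝓘(ℝ, E) 2 M := IsManifold.of_le (n := ∞) (by norm_cast)
    filter_upwards [(contMDiffAt_iff_contMDiffAt_nhds (by simp)).1 hf] with y hy using
      hy.mdifferentiableAt (by simp)
  have hc : ContinuousAt (extChartAt 𝓘(ℝ, E) x).symm (extChartAt 𝓘(ℝ, E) x x) :=
    continuousAt_extChartAt_symm x
  have hd' : ∀ᶠ a in 𝓝 (extChartAt 𝓘(ℝ, E) x x),
      MDiffAt f ((extChartAt 𝓘(ℝ, E) x).symm a) := by
    apply hc.eventually
    rwa [extChartAt_to_inv]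
  filter_upwards [hd', extChartAt_target_mem_nhds (I := 𝓘(ℝ, E)) x] with a ha hat
  have hs := (extChartAt 𝓘(ℝ, E) x).map_target hat
  have h1 := mvfderiv_eq_fderiv_comp_extChartAt_symm hs ha (V _)
  rw [← mpullbackWithin_extChartAt_symm_apply V hs] at h1
  rw [(extChartAt 𝓘(ℝ, E) x).right_inv hat] at h1
  exact h1

variable [CompleteSpace E]

lemma differentiableAt_mpullbackWithin_extChartAt_symm {V : Π x : M, TangentSpace 𝓘(ℝ, E) x}
    {x : M} (hV : MDiffAt (T% V) x) :
    DifferentiableAt ℝ (F := E) (mpullbackWithin 𝓘(ℝ, E) 𝓘(ℝ, E) (extChartAt 𝓘(ℝ, E) x).symm V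
      (Set.range 𝓘(ℝ, E))) (extChartAt 𝓘(ℝ, E) x x) := by
  have : IsManifold 𝓘(ℝ, E) 2 M := IsManifold.of_le (n := ∞) (by norm_cast)
  have := MDifferentiableWithinAt.differentiableWithinAt_mpullbackWithin_vectorField
    (mdifferentiableWithinAt_univ.2 hV)
  exact this.differentiableAt (by simp)

lemma mdifferentiableAt_mvfderiv_apply {f : M → ℝ} {V : Π x : M, TangentSpace 𝓘(ℝ, E) x} {x : M}
    (hf : CMDiffAt 2 f x) (hV : MDiffAt (T% V) x) :
    MDiffAt (fun y ↦ mvfderiv 𝓘(ℝ, E) f y (V y)) x := by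
  have h1 := mvfderiv_apply_comp_extChartAt_symm_eventuallyEq hf V
  have h2 : DifferentiableAt ℝ ((fun y ↦ mvfderiv 𝓘(ℝ, E) f y (V y)) ∘
      (extChartAt 𝓘(ℝ, E) x).symm) (extChartAt 𝓘(ℝ, E) x x) := by
    refine DifferentiableAt.congr_of_eventuallyEq ?_ h1
    have h3 := (contDiffAt_comp_extChartAt_symm hf).fderiv_right (m := 1) (by norm_num)
    exact (h3.differentiableAt (by simp)).clm_apply
      (differentiableAt_mpullbackWithin_extChartAt_symm hV)
  have h4 : MDifferentiableAt 𝓘(ℝ, E) 𝓘(ℝ, E) (extChartAt 𝓘(ℝ, E) x) x :=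
    mdifferentiableAt_extChartAt (by simp)
  exact (h2.mdifferentiableAt.comp x h4).congr_of_eventuallyEq
    (comp_extChartAt_symm_comp_extChartAt_eventuallyEq _ (mem_extChartAt_source x)).symm

/-- The second derivative `V (W f)` read in the chart. -/
lemma mvfderiv_mvfderiv_apply {f : M → ℝ} {V W : Π x : M, TangentSpace 𝓘(ℝ, E) x} {x : M}
    (hf : CMDiffAt 2 f x) (hW : MDiffAt (T% W) x) {f' : E → ℝ} {V' W' : E → E} {a : E}
    (hf' : f' = f ∘ (extChartAt 𝓘(ℝ, E) x).symm)
    (hV' : V' = mpullbackWithin 𝓘(ℝ, E) 𝓘(ℝ, E) (extChartAt 𝓘(ℝ, E) x).symm V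
      (Set.range 𝓘(ℝ, E)))
    (hW' : W' = mpullbackWithin 𝓘(ℝ, E) 𝓘(ℝ, E) (extChartAt 𝓘(ℝ, E) x).symm W
      (Set.range 𝓘(ℝ, E)))
    (ha : a = extChartAt 𝓘(ℝ, E) x x) :
    mvfderiv 𝓘(ℝ, E) (fun y ↦ mvfderiv 𝓘(ℝ, E) f y (W y)) x (V x) =
      fderiv ℝ (fderiv ℝ f') a (V' a) (W' a) + fderiv ℝ f' a (fderiv ℝ W' a (V' a)) := by
  have h1 := mvfderiv_apply_comp_extChartAt_symm_eventuallyEq hf W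
  have h2 := mvfderiv_eq_fderiv_comp_extChartAt_symm (mem_extChartAt_source x)
    (mdifferentiableAt_mvfderiv_apply hf hW) (V x)
  rw [← mpullbackWithin_extChartAt_symm_apply V (mem_extChartAt_source x), h1.fderiv_eq] at h2
  rw [h2]
  have h3 := (contDiffAt_comp_extChartAt_symm hf).fderiv_right (m := 1) (by norm_num)
  have h4 := differentiableAt_mpullbackWithin_extChartAt_symm hW
  rw [← hf', ← ha] at h3
  rw [← ha, ← hW'] at h4
  rw [← ha, ← hW', ← hV', ← hf', fderiv_clm_apply (h3.differentiableAt (by simp)) h4]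
  simp [add_comm]

omit [CompleteSpace E] in
lemma fderiv_lieBracketWithin {f : E → ℝ} {V W : E → E} {a : E} {s : Set E}
    (hf : IsSymmSndFDerivAt ℝ f a) (hs : s = Set.univ) :
    fderiv ℝ f a (lieBracketWithin ℝ V W s a) =
      (fderiv ℝ (fderiv ℝ f) a (V a) (W a) + fderiv ℝ f a (fderiv ℝ W a (V a))) -
      (fderiv ℝ (fderiv ℝ f) a (W a) (V a) + fderiv ℝ f a (fderiv ℝ V a (W a))) := by
  rw [hf.eq, hs, lieBracketWithin_univ, lieBracket, map_sub]
  ring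

/-- The Lie bracket of vector fields acts on functions as the commutator of derivations. -/
theorem mvfderiv_mlieBracket {f : M → ℝ} {V W : Π x : M, TangentSpace 𝓘(ℝ, E) x} {x : M}
    (hf : CMDiffAt 2 f x) (hV : MDiffAt (T% V) x) (hW : MDiffAt (T% W) x) :
    mvfderiv 𝓘(ℝ, E) f x (mlieBracket 𝓘(ℝ, E) V W x) =
      mvfderiv 𝓘(ℝ, E) (fun y ↦ mvfderiv 𝓘(ℝ, E) f y (W y)) x (V x) -
      mvfderiv 𝓘(ℝ, E) (fun y ↦ mvfderiv 𝓘(ℝ, E) f y (V y)) x (W x) := by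
  rw [mvfderiv_mvfderiv_apply hf hW rfl rfl rfl rfl, mvfderiv_mvfderiv_apply hf hV rfl rfl rfl rfl,
    mvfderiv_eq_fderiv_comp_extChartAt_symm (mem_extChartAt_source x)
      (hf.mdifferentiableAt (by simp)),
    ← mlieBracketWithin_univ, mlieBracketWithin_apply]
  have hinv : ∀ u, mfderiv 𝓘(ℝ, E) 𝓘(ℝ, E) (extChartAt 𝓘(ℝ, E) x) x
      ((mfderiv 𝓘(ℝ, E) 𝓘(ℝ, E) (extChartAt 𝓘(ℝ, E) x) x).inverse u) = u := fun u ↦ by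
    have : IsManifold 𝓘(ℝ, E) 1 M := IsManifold.of_le (n := ∞) (by norm_cast)
    exact (isInvertible_mfderiv_extChartAt
      (mem_extChartAt_source (I := 𝓘(ℝ, E)) x)).self_apply_inverse u
  erw [hinv]
  exact fderiv_lieBracketWithin
    ((contDiffAt_comp_extChartAt_symm hf).isSymmSndFDerivAt (by simp)) (by simp)

omit [CompleteSpace E] in
lemma eq_zero_of_forall_mvfderiv_eq_zero {x : M} {v : TangentSpace 𝓘(ℝ, E) x}
    (h : ∀ f : M → ℝ, CMDiffAt ∞ f x → mvfderiv 𝓘(ℝ, E) f x v = 0) : v = 0 := by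
  have : IsManifold 𝓘(ℝ, E) 1 M := IsManifold.of_le (n := ∞) (by norm_cast)
  have hinv := isInvertible_mfderiv_extChartAt (mem_extChartAt_source (I := 𝓘(ℝ, E)) x)
  have hmd : MDifferentiableAt 𝓘(ℝ, E) 𝓘(ℝ, E) (extChartAt 𝓘(ℝ, E) x) x :=
    mdifferentiableAt_extChartAt (by simp)
  apply hinv.injective
  rw [map_zero]
  refine SeparatingDual.eq_zero_of_forall_dual_eq_zero (R := ℝ) (V := E) fun l ↦ ?_
  have h1 := h (l ∘ extChartAt 𝓘(ℝ, E) x) (l.contDiff.contMDiff.contMDiffAt.comp x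
    contMDiffAt_extChartAt)
  have h2 := mfderiv_comp_apply x l.differentiableAt.mdifferentiableAt hmd v
  rw [mfderiv_eq_fderiv, l.fderiv] at h2
  exact h2.symm.trans h1

end BracketOnFunctions

section InvariantFields

variable {E : Type*} [NormedAddCommGroup E] [NormedSpace ℝ E]
  {G : Type*} [TopologicalSpace G] [ChartedSpace E G] [Group G]

lemma lieGroup_minSmoothness [LieGroup 𝓘(ℝ, E) ∞ G] :
    LieGroup 𝓘(ℝ, E) (minSmoothness ℝ 3) G :=
  LieGroup.of_le (n := ∞) (by simp only [minSmoothness_of_isRCLikeNormedField]; norm_cast)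

attribute [local instance] lieGroup_minSmoothness

/-- The right-invariant vector field with value `v` at the identity. -/
def mulRightInvariantVectorField (v : GroupLieAlgebra 𝓘(ℝ, E) G) (g : G) :
    TangentSpace 𝓘(ℝ, E) g :=
  mfderiv 𝓘(ℝ, E) 𝓘(ℝ, E) (fun x : G ↦ x * g) (1 : G) v

omit [Group G] in
lemma mfderiv_apply_of_eq_id {m : G → G} (hm : m = id) {g : G} (v : TangentSpace 𝓘(ℝ, E) g) :
    (mfderiv 𝓘(ℝ, E) 𝓘(ℝ, E) m g v : E) = v := by
  subst hm
  rw [mfderiv_id]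
  rfl

lemma mulRightInvariantVectorField_one (v : GroupLieAlgebra 𝓘(ℝ, E) G) :
    mulRightInvariantVectorField v (1 : G) = v :=
  mfderiv_apply_of_eq_id (by ext; simp) v

lemma mulInvariantVectorField_one (v : GroupLieAlgebra 𝓘(ℝ, E) G) :
    mulInvariantVectorField v (1 : G) = v :=
  mfderiv_apply_of_eq_id (by ext; simp) v

variable [LieGroup 𝓘(ℝ, E) ∞ G]

lemma contMDiff_mulInvariantVectorField_two (v : GroupLieAlgebra 𝓘(ℝ, E) G) :
    CMDiff 2 (T% (mulInvariantVectorField v : Π g : G, TangentSpace 𝓘(ℝ, E) g)) := by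
  have := contMDiff_mulInvariantVectorField v
  simpa only [minSmoothness_of_isRCLikeNormedField] using this

lemma mdifferentiableAt_mulRightInvariantVectorField (v : GroupLieAlgebra 𝓘(ℝ, E) G) (g : G) :
    MDiffAt (T% (mulRightInvariantVectorField v : Π g : G, TangentSpace 𝓘(ℝ, E) g)) g := by
  let fg : G → TangentBundle 𝓘(ℝ, E) G := fun g ↦ TotalSpace.mk' E g 0
  have sfg : CMDiff 1 fg := contMDiff_zeroSection _ _
  let fv : G → TangentBundle 𝓘(ℝ, E) G := fun _ ↦ TotalSpace.mk' E 1 v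
  have sfv : CMDiff 1 fv := contMDiff_const
  let F₁ : G → (TangentBundle 𝓘(ℝ, E) G × TangentBundle 𝓘(ℝ, E) G) := fun g ↦ (fv g, fg g)
  have S₁ : CMDiff 1 F₁ := sfv.prodMk sfg
  let F₂ : (TangentBundle 𝓘(ℝ, E) G × TangentBundle 𝓘(ℝ, E) G) →
      TangentBundle (𝓘(ℝ, E).prod 𝓘(ℝ, E)) (G × G) :=
    (equivTangentBundleProd 𝓘(ℝ, E) G 𝓘(ℝ, E) G).symm
  have S₂ : CMDiff 1 F₂ := contMDiff_equivTangentBundleProd_symm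
  let F₃ : TangentBundle (𝓘(ℝ, E).prod 𝓘(ℝ, E)) (G × G) → TangentBundle 𝓘(ℝ, E) G :=
    tangentMap (𝓘(ℝ, E).prod 𝓘(ℝ, E)) 𝓘(ℝ, E) (fun (p : G × G) ↦ p.1 * p.2)
  have S₃ : CMDiff 1 F₃ :=
    ContMDiff.contMDiff_tangentMap (n := ∞) (contMDiff_mul 𝓘(ℝ, E) ∞) (m := 1) (by norm_cast)
  let S := (S₃.comp S₂).comp S₁
  have hS : CMDiff 1 (T% (mulRightInvariantVectorField v : Π g : G, TangentSpace 𝓘(ℝ, E) g)) := by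
    convert! S with g
    · simp [F₁, F₂, F₃, fg, fv]
    · simp only [Function.comp_apply, tangentMap, F₃, F₂, F₁, fg, fv]
      rw [mfderiv_prod_eq_add_apply ((contMDiff_mul 𝓘(ℝ, E) ∞).mdifferentiableAt (by simp))]
      refine Eq.symm ((congrArg (fun w : TangentSpace 𝓘(ℝ, E) (1 * g) ↦
        mfderiv 𝓘(ℝ, E) 𝓘(ℝ, E) (fun x : G ↦ x * g) 1 v + w) (map_zero _)).trans (add_zero _))
  exact hS.mdifferentiable (by simp) g

lemma mvfderiv_comp_extChartAt_one_symm {k : G → ℝ} {m : G → G} {g : G} (hm : m 1 = g)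
    (hmd : MDiffAt m 1) (hk : MDiffAt k g) (v : GroupLieAlgebra 𝓘(ℝ, E) G) :
    mvfderiv 𝓘(ℝ, E) k g (mfderiv 𝓘(ℝ, E) 𝓘(ℝ, E) m 1 v) =
      fderiv ℝ (fun a ↦ k (m ((extChartAt 𝓘(ℝ, E) (1 : G)).symm a))) (extChartAt 𝓘(ℝ, E) (1 : G) 1)
        (mfderiv 𝓘(ℝ, E) 𝓘(ℝ, E) (extChartAt 𝓘(ℝ, E) (1 : G)) 1 v) := by
  have : IsManifold 𝓘(ℝ, E) 1 G := IsManifold.of_le (n := ∞) (by norm_cast)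
  subst hm
  have h1 := mvfderiv_eq_fderiv_comp_extChartAt_symm (mem_extChartAt_source (I := 𝓘(ℝ, E)) (1 : G))
    (hk.comp (1 : G) hmd) v
  rw [mvfderiv_comp_apply _ hk hmd] at h1
  exact h1

lemma mvfderiv_mulRightInvariantVectorField {k : G → ℝ} {g : G} (hk : MDiffAt k g)
    (v : GroupLieAlgebra 𝓘(ℝ, E) G) :
    mvfderiv 𝓘(ℝ, E) k g (mulRightInvariantVectorField v g) =
      fderiv ℝ (fun a ↦ k ((extChartAt 𝓘(ℝ, E) (1 : G)).symm a * g))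
        (extChartAt 𝓘(ℝ, E) (1 : G) 1)
        (mfderiv 𝓘(ℝ, E) 𝓘(ℝ, E) (extChartAt 𝓘(ℝ, E) (1 : G)) 1 v) :=
  mvfderiv_comp_extChartAt_one_symm (m := fun x ↦ x * g) (one_mul g)
    ((contMDiff_mul_right (n := ∞)).mdifferentiableAt (by simp)) hk v

lemma mvfderiv_mulInvariantVectorField {k : G → ℝ} {g : G} (hk : MDiffAt k g)
    (v : GroupLieAlgebra 𝓘(ℝ, E) G) :
    mvfderiv 𝓘(ℝ, E) k g (mulInvariantVectorField v g) =
      fderiv ℝ (fun a ↦ k (g * (extChartAt 𝓘(ℝ, E) (1 : G)).symm a))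
        (extChartAt 𝓘(ℝ, E) (1 : G) 1)
        (mfderiv 𝓘(ℝ, E) 𝓘(ℝ, E) (extChartAt 𝓘(ℝ, E) (1 : G)) 1 v) :=
  mvfderiv_comp_extChartAt_one_symm (m := fun x ↦ g * x) (mul_one g)
    ((contMDiff_mul_left (n := ∞)).mdifferentiableAt (by simp)) hk v

lemma fderiv_fderiv_comp_prodMk_left {F : E × E → ℝ} {a b : E} (hF : ContDiffAt ℝ 2 F (a, b))
    (u w : E) :
    fderiv ℝ (fun x ↦ fderiv ℝ (fun y ↦ F (x, y)) b w) a u =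
      fderiv ℝ (fderiv ℝ F) (a, b) (u, 0) (0, w) := by
  have hd : ∀ᶠ p in 𝓝 (a, b), DifferentiableAt ℝ F p := by
    filter_upwards [hF.eventually (by simp)] with p hp using hp.differentiableAt (by simp)
  have hc : ContinuousAt (fun x : E ↦ (x, b)) a := by fun_prop
  have h1 : (fun x ↦ fderiv ℝ (fun y ↦ F (x, y)) b w) =ᶠ[𝓝 a]
      fun x ↦ fderiv ℝ F (x, b) (0, w) := by
    filter_upwards [hc.eventually hd] with x hx
    have h2 : HasFDerivAt (fun y : E ↦ (x, y)) (ContinuousLinearMap.inr ℝ E E) b :=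
      hasFDerivAt_prodMk_right x b
    refine (congrArg (· w) (hx.hasFDerivAt.comp b h2).fderiv).trans ?_
    simp
  have h3 : HasFDerivAt (fun x : E ↦ (x, b)) (ContinuousLinearMap.inl ℝ E E) a :=
    hasFDerivAt_prodMk_left a b
  have h4 : DifferentiableAt ℝ (fderiv ℝ F) (a, b) :=
    (hF.fderiv_right (m := 1) (by norm_num)).differentiableAt (by simp)
  have h5 := (h4.hasFDerivAt.comp a h3).clm_apply (hasFDerivAt_const ((0 : E), w) a)
  rw [h1.fderiv_eq]
  refine (congrArg (· u) h5.fderiv).trans ?_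
  simp

lemma fderiv_fderiv_comp_prodMk_right {F : E × E → ℝ} {a b : E} (hF : ContDiffAt ℝ 2 F (a, b))
    (u w : E) :
    fderiv ℝ (fun y ↦ fderiv ℝ (fun x ↦ F (x, y)) a u) b w =
      fderiv ℝ (fderiv ℝ F) (a, b) (0, w) (u, 0) := by
  have hd : ∀ᶠ p in 𝓝 (a, b), DifferentiableAt ℝ F p := by
    filter_upwards [hF.eventually (by simp)] with p hp using hp.differentiableAt (by simp)
  have hc : ContinuousAt (fun y : E ↦ (a, y)) b := by fun_prop
  have h1 : (fun y ↦ fderiv ℝ (fun x ↦ F (x, y)) a u) =ᶠ[𝓝 b]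
      fun y ↦ fderiv ℝ F (a, y) (u, 0) := by
    filter_upwards [hc.eventually hd] with y hy
    have h2 : HasFDerivAt (fun x : E ↦ (x, y)) (ContinuousLinearMap.inl ℝ E E) a :=
      hasFDerivAt_prodMk_left a y
    refine (congrArg (· u) (hy.hasFDerivAt.comp a h2).fderiv).trans ?_
    simp
  have h3 : HasFDerivAt (fun y : E ↦ (a, y)) (ContinuousLinearMap.inr ℝ E E) b :=
    hasFDerivAt_prodMk_right a b
  have h4 : DifferentiableAt ℝ (fderiv ℝ F) (a, b) :=
    (hF.fderiv_right (m := 1) (by norm_num)).differentiableAt (by simp)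
  have h5 := (h4.hasFDerivAt.comp b h3).clm_apply (hasFDerivAt_const (u, (0 : E)) b)
  rw [h1.fderiv_eq]
  refine (congrArg (· w) h5.fderiv).trans ?_
  simp

lemma contDiffAt_mul_extChartAt_one_symm {f : G → ℝ} {g : G} (hf : CMDiffAt 2 f g) :
    ContDiffAt ℝ 2 (fun p : E × E ↦ f ((extChartAt 𝓘(ℝ, E) (1 : G)).symm p.1 * g *
      (extChartAt 𝓘(ℝ, E) (1 : G)).symm p.2))
      (extChartAt 𝓘(ℝ, E) (1 : G) 1, extChartAt 𝓘(ℝ, E) (1 : G) 1) := by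
  set b₀ := extChartAt 𝓘(ℝ, E) (1 : G) 1
  have hψ : ContMDiffAt 𝓘(ℝ, E) 𝓘(ℝ, E) ∞ (extChartAt 𝓘(ℝ, E) (1 : G)).symm b₀ :=
    (contMDiffOn_extChartAt_symm (1 : G)).contMDiffAt (extChartAt_target_mem_nhds 1)
  have h1 : ContMDiffAt 𝓘(ℝ, E × E) 𝓘(ℝ, E) ∞
      (fun p : E × E ↦ (extChartAt 𝓘(ℝ, E) (1 : G)).symm p.1) (b₀, b₀) :=
    ContMDiffAt.comp (b₀, b₀) (g := (extChartAt 𝓘(ℝ, E) (1 : G)).symm) hψ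
      contDiff_fst.contMDiff.contMDiffAt
  have h2 : ContMDiffAt 𝓘(ℝ, E × E) 𝓘(ℝ, E) ∞
      (fun p : E × E ↦ (extChartAt 𝓘(ℝ, E) (1 : G)).symm p.2) (b₀, b₀) :=
    ContMDiffAt.comp (b₀, b₀) (g := (extChartAt 𝓘(ℝ, E) (1 : G)).symm) hψ
      contDiff_snd.contMDiff.contMDiffAt
  have h3 := ((h1.mul (contMDiffAt_const (c := g))).mul h2).of_le (m := 2) (by norm_cast)
  refine ContMDiffAt.contDiffAt (ContMDiffAt.comp (b₀, b₀) (g := f) ?_ h3)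
  simpa [b₀] using hf

variable [CompleteSpace E]

/-- Right-invariant and left-invariant vector fields commute. -/
theorem mlieBracket_mulRightInvariantVectorField (k v : GroupLieAlgebra 𝓘(ℝ, E) G) (g : G) :
    mlieBracket 𝓘(ℝ, E) (mulRightInvariantVectorField k) (mulInvariantVectorField v) g = 0 := by
  refine eq_zero_of_forall_mvfderiv_eq_zero fun f hf ↦ ?_
  replace hf : CMDiffAt 2 f g := hf.of_le (by norm_cast)
  have hL := mdifferentiableAt_mulInvariantVectorField v (g := g)
  have hR := mdifferentiableAt_mulRightInvariantVectorField k g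
  have hF := contDiffAt_mul_extChartAt_one_symm hf
  have : IsManifold 𝓘(ℝ, E) 2 G := IsManifold.of_le (n := ∞) (by norm_cast)
  have hfd : ∀ᶠ y in 𝓝 g, MDiffAt f y := by
    filter_upwards [(contMDiffAt_iff_contMDiffAt_nhds (by simp)).1 hf] with y hy using
      hy.mdifferentiableAt (by simp)
  have hc : ContinuousAt (extChartAt 𝓘(ℝ, E) (1 : G)).symm (extChartAt 𝓘(ℝ, E) (1 : G) 1) :=
    continuousAt_extChartAt_symm 1
  rw [mvfderiv_mlieBracket hf hR hL,
    mvfderiv_mulRightInvariantVectorField (mdifferentiableAt_mvfderiv_apply hf hL),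
    mvfderiv_mulInvariantVectorField (mdifferentiableAt_mvfderiv_apply hf hR)]
  set ψ := (extChartAt 𝓘(ℝ, E) (1 : G)).symm
  set b₀ := extChartAt 𝓘(ℝ, E) (1 : G) 1
  have hψ : ψ b₀ = 1 := extChartAt_to_inv 1
  have : ContinuousMul G := continuousMul_of_contMDiffMul 𝓘(ℝ, E) ∞
  have e1 : ∀ᶠ a in 𝓝 b₀, MDiffAt f (ψ a * g) := by
    have : ContinuousAt (fun a ↦ ψ a * g) b₀ := hc.mul continuousAt_const
    apply this.eventually
    simpa [hψ] using hfd
  have e2 : ∀ᶠ a in 𝓝 b₀, MDiffAt f (g * ψ a) := by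
    have : ContinuousAt (fun a ↦ g * ψ a) b₀ := continuousAt_const.mul hc
    apply this.eventually
    simpa [hψ] using hfd
  have e3 := e1.mono fun a ha ↦ mvfderiv_mulInvariantVectorField ha v
  have e4 := e2.mono fun a ha ↦ mvfderiv_mulRightInvariantVectorField ha k
  rw [Filter.EventuallyEq.fderiv_eq e3, Filter.EventuallyEq.fderiv_eq e4, sub_eq_zero]
  have h1 := fderiv_fderiv_comp_prodMk_left hF
    (mfderiv 𝓘(ℝ, E) 𝓘(ℝ, E) (extChartAt 𝓘(ℝ, E) (1 : G)) 1 k)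
    (mfderiv 𝓘(ℝ, E) 𝓘(ℝ, E) (extChartAt 𝓘(ℝ, E) (1 : G)) 1 v)
  have h2 := fderiv_fderiv_comp_prodMk_right hF
    (mfderiv 𝓘(ℝ, E) 𝓘(ℝ, E) (extChartAt 𝓘(ℝ, E) (1 : G)) 1 k)
    (mfderiv 𝓘(ℝ, E) 𝓘(ℝ, E) (extChartAt 𝓘(ℝ, E) (1 : G)) 1 v)
  rw [(hF.isSymmSndFDerivAt (by simp)).eq, ← h2] at h1
  simpa only [mul_assoc] using h1

end InvariantFields

section AlgebraicConnection

variable {V : Type*} [NormedAddCommGroup V] [InnerProductSpace ℝ V]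

/-- The curvature of a left-invariant connection `N` on a Lie group, expressed on the Lie
algebra; the bracket is `N x y - N y x`, the connection being torsion-free. -/
def algebraicCurvature (N : V →ₗ[ℝ] V →ₗ[ℝ] V) (x y z : V) : V :=
  N x (N y z) - N y (N x z) - N (N x y - N y x) z

lemma inner_algebraicCurvature_le_zero {N : V →ₗ[ℝ] V →ₗ[ℝ] V}
    (hskew : ∀ x y z, (inner ℝ (N x y) z : ℝ) = - inner ℝ y (N x z))
    (h : ∀ x y, LinearIndependent ℝ ![x, y] → (inner ℝ (algebraicCurvature N x y y) x : ℝ) ≤ 0)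
    (x y : V) : (inner ℝ (algebraicCurvature N x y y) x : ℝ) ≤ 0 := by
  by_cases hl : LinearIndependent ℝ ![x, y]
  · exact h x y hl
  have h0 : ∀ a b : V, (inner ℝ (N a b) b : ℝ) = 0 := fun a b ↦ by
    have := hskew a b b
    rw [real_inner_comm (N a b) b] at this
    linarith
  apply le_of_eq
  by_cases hy : y = 0
  · simp [hy, algebraicCurvature]
  rw [linearIndependent_fin2] at hl
  simp only [Matrix.cons_val_one, Matrix.cons_val_zero, ne_eq, not_and, not_forall,
    not_not] at hl
  obtain ⟨a, rfl⟩ := hl hy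
  simp [algebraicCurvature]

variable [FiniteDimensional ℝ V]

lemma hasDerivAt_of_forall_inner {u : ℝ → V} {w : V} {t : ℝ}
    (h : ∀ z : V, HasDerivAt (fun s ↦ (inner ℝ (u s) z : ℝ)) (inner ℝ w z) t) :
    HasDerivAt u w t := by
  let b := stdOrthonormalBasis ℝ V
  have h1 : ∀ v : V, v = ∑ i, (inner ℝ v (b i) : ℝ) • b i := fun v ↦ by
    conv_lhs => rw [← b.sum_repr' v]
    simp only [real_inner_comm]
  rw [h1 w, funext fun s ↦ h1 (u s)]
  exact HasDerivAt.fun_sum fun i _ ↦ (h (b i)).smul_const (b i)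

lemma hasDerivAt_bilinear (N : V →ₗ[ℝ] V →ₗ[ℝ] V) {u y : ℝ → V} {u' y' : V} {t : ℝ}
    (hu : HasDerivAt u u' t) (hy : HasDerivAt y y' t) :
    HasDerivAt (fun s ↦ N (y s) (u s)) (N y' (u t) + N (y t) u') t := by
  let B : V →L[ℝ] V →L[ℝ] V := LinearMap.toContinuousLinearMap
    ((LinearMap.toContinuousLinearMap : (V →ₗ[ℝ] V) ≃ₗ[ℝ] V →L[ℝ] V).toLinearMap ∘ₗ N)
  have h1 := (B.hasFDerivAt.comp_hasDerivAt t hy).clm_apply hu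
  exact h1

/-- A Jacobi field coming from a Killing field, read in the left trivialisation, has convex norm
in nonpositive curvature. If its norm takes the same value at `0` and `τ > 0`, then it is
nonincreasing at `0`. -/
lemma inner_le_zero_of_convex {N : V →ₗ[ℝ] V →ₗ[ℝ] V}
    (hskew : ∀ x y z, (inner ℝ (N x y) z : ℝ) = - inner ℝ y (N x z))
    (hcurv : ∀ x y, (inner ℝ (algebraicCurvature N x y y) x : ℝ) ≤ 0)
    {u y : ℝ → V} {τ : ℝ} (hτ : 0 < τ)
    (hu : ∀ t ∈ Set.Icc 0 τ, ∀ z, HasDerivAt (fun s ↦ (inner ℝ (u s) z : ℝ))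
      (inner ℝ (u t) (N (u t) z)) t)
    (hy : ∀ t ∈ Set.Icc 0 τ, ∀ z, HasDerivAt (fun s ↦ (inner ℝ (y s) z : ℝ))
      (inner ℝ (N (y t) (u t)) z + inner ℝ (y t) (N (u t) z)) t)
    (hend : (inner ℝ (y τ) (y τ) : ℝ) = inner ℝ (y 0) (y 0)) :
    (inner ℝ (N (y 0) (u 0)) (y 0) : ℝ) ≤ 0 := by
  have hu' : ∀ t ∈ Set.Icc 0 τ, HasDerivAt u (- N (u t) (u t)) t := fun t ht ↦
    hasDerivAt_of_forall_inner fun z ↦ by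
      rw [inner_neg_left, hskew, neg_neg]
      exact hu t ht z
  have hy' : ∀ t ∈ Set.Icc 0 τ, HasDerivAt y (N (y t) (u t) - N (u t) (y t)) t := fun t ht ↦
    hasDerivAt_of_forall_inner fun z ↦ by
      rw [inner_sub_left, hskew (u t), sub_neg_eq_add]
      exact hy t ht z
  have h0 : ∀ a b : V, (inner ℝ (N a b) b : ℝ) = 0 := fun a b ↦ by
    have := hskew a b b
    rw [real_inner_comm (N a b) b] at this
    linarith
  set h : ℝ → ℝ := fun t ↦ inner ℝ (N (y t) (u t)) (y t) with hdef
  have hf : ∀ t ∈ Set.Icc 0 τ, HasDerivAt (fun s ↦ (inner ℝ (y s) (y s) : ℝ)) (2 * h t) t := by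
    intro t ht
    refine ((hy' t ht).inner ℝ (hy' t ht)).congr_deriv ?_
    rw [inner_sub_left, inner_sub_right, h0, real_inner_comm (N (u t) (y t)) (y t), h0,
      real_inner_comm (N (y t) (u t)) (y t), hdef]
    ring
  have hh : ∀ t ∈ Set.Icc 0 τ, HasDerivAt h (‖N (y t) (u t)‖ ^ 2
      - inner ℝ (algebraicCurvature N (y t) (u t) (u t)) (y t)) t := by
    intro t ht
    refine ((hasDerivAt_bilinear N (hu' t ht) (hy' t ht)).inner ℝ (hy' t ht)).congr_deriv ?_
    simp only [algebraicCurvature, map_sub, map_neg, LinearMap.sub_apply, inner_sub_left,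
      inner_sub_right, inner_add_left, inner_neg_left, real_inner_self_eq_norm_sq]
    rw [hskew (u t) (N (y t) (u t)) (y t)]
    ring
  have hmono : MonotoneOn h (Set.Icc 0 τ) := by
    refine monotoneOn_of_deriv_nonneg (convex_Icc 0 τ)
      (fun t ht ↦ (hh t ht).continuousAt.continuousWithinAt)
      (fun t ht ↦ (hh t (interior_subset ht)).differentiableAt.differentiableWithinAt)
      (fun t ht ↦ ?_)
    rw [(hh t (interior_subset ht)).deriv]
    have := hcurv (y t) (u t)
    exact sub_nonneg.2 (this.trans (sq_nonneg _))
  obtain ⟨c, hc, hc'⟩ := exists_hasDerivAt_eq_slope (fun s ↦ (inner ℝ (y s) (y s) : ℝ))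
    (fun t ↦ 2 * h t) hτ (fun t ht ↦ (hf t ht).continuousAt.continuousWithinAt)
    (fun t ht ↦ hf t (Set.Ioo_subset_Icc_self ht))
  simp only [hend, sub_self, zero_div] at hc'
  have := hmono (Set.left_mem_Icc.2 hτ.le) (Set.Ioo_subset_Icc_self hc) hc.1.le
  linarith

lemma eq_zero_of_dense {N : V →ₗ[ℝ] V →ₗ[ℝ] V}
    (hskew : ∀ x y z, (inner ℝ (N x y) z : ℝ) = - inner ℝ y (N x z))
    (hcurv : ∀ x y, (inner ℝ (algebraicCurvature N x y y) x : ℝ) ≤ 0)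
    (hdense : ∀ v : V, ‖v‖ = 1 → ∀ ε > (0 : ℝ), ∃ w : V, ‖v - w‖ < ε ∧
      ∀ x, (inner ℝ (N x w) x : ℝ) ≤ 0) : N = 0 := by
  have h1 : ∀ v : V, ‖v‖ = 1 → ∀ x, (inner ℝ (N x v) x : ℝ) ≤ 0 := by
    intro v hv x
    have hcl : IsClosed {w : V | (inner ℝ (N x w) x : ℝ) ≤ 0} := by
      have : Continuous (N x) := (N x).continuous_of_finiteDimensional
      exact isClosed_le (by fun_prop) continuous_const
    refine (hcl.closure_eq ▸ Metric.mem_closure_iff.2 fun ε hε ↦ ?_ : v ∈ {w : V | _})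
    obtain ⟨w, hw, hw'⟩ := hdense v hv ε hε
    exact ⟨w, hw' x, by rwa [dist_eq_norm]⟩
  have h2 : ∀ v x : V, (inner ℝ (N x v) x : ℝ) ≤ 0 := by
    intro v x
    by_cases hv : v = 0
    · simp [hv]
    have h3 := h1 (‖v‖⁻¹ • v) (norm_smul_inv_norm hv) x
    rw [map_smul, real_inner_smul_left] at h3
    exact nonpos_of_mul_nonpos_right h3 (by positivity)
  have h3 : ∀ v x : V, (inner ℝ (N x v) x : ℝ) = 0 := fun v x ↦
    le_antisymm (h2 v x) (by simpa using h2 (-v) x)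
  have h4 : ∀ x : V, N x x = 0 := fun x ↦ ext_inner_left ℝ fun v ↦ by
    have := hskew x v x
    rw [h3] at this
    rw [inner_zero_right]
    linarith
  have h5 : ∀ x y : V, N y x = - N x y := fun x y ↦ by
    have := h4 (x + y)
    simp only [map_add, LinearMap.add_apply, h4] at this
    rw [zero_add, add_zero] at this
    exact eq_neg_of_add_eq_zero_left this
  ext x y
  have h6 : (inner ℝ (algebraicCurvature N x y y) x : ℝ) = ‖N x y‖ ^ 2 := by
    have e1 : N (N x y) y = - N y (N x y) := h5 _ _
    have e2 : (inner ℝ (N y (N x y)) x : ℝ) = ‖N x y‖ ^ 2 := by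
      rw [hskew, h5 x y, inner_neg_right, neg_neg, real_inner_self_eq_norm_sq]
    simp only [algebraicCurvature, h4, map_zero, h5 x y, sub_neg_eq_add, map_add,
      LinearMap.add_apply, e1, inner_sub_left, inner_add_left, inner_neg_left, inner_zero_left, e2]
    ring
  have h7 := hcurv x y
  rw [h6] at h7
  have h8 : ‖N x y‖ = 0 := by
    have := sq_nonneg ‖N x y‖
    exact pow_eq_zero_iff (two_ne_zero) |>.1 (le_antisymm h7 this)
  simpa using h8

end AlgebraicConnection

section AlongCurves

variable {E : Type*} [NormedAddCommGroup E] [NormedSpace ℝ E]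
  {H : Type*} [TopologicalSpace H] {I : ModelWithCorners ℝ E H}
  {M : Type*} [TopologicalSpace M] [ChartedSpace H M]

lemma hasDerivAt_comp_curve {φ : M → ℝ} {γ : ℝ → M} {t : ℝ}
    (hφ : MDifferentiableAt I 𝓘(ℝ, ℝ) φ (γ t)) (hγ : MDifferentiableAt 𝓘(ℝ, ℝ) I γ t) :
    HasDerivAt (fun s ↦ φ (γ s)) (mvfderiv I φ (γ t) (velocity I γ t)) t :=
by
  let A : ℝ →L[ℝ] ℝ := (mfderiv I 𝓘(ℝ, ℝ) φ (γ t)).comp (mfderiv 𝓘(ℝ, ℝ) I γ t)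
  have h : HasFDerivAt (fun s ↦ φ (γ s)) A t :=
    hasMFDerivAt_iff_hasFDerivAt.1 (hφ.hasMFDerivAt.comp t hγ.hasMFDerivAt)
  exact h.hasDerivAt

variable [FiniteDimensional ℝ E] [IsManifold I ∞ M]
  [RiemannianBundle (fun x : M ↦ TangentSpace I x)]
  [IsContMDiffRiemannianBundle I ∞ E (fun x : M ↦ TangentSpace I x)]

lemma mvfderiv_inner {Y Z : Π x : M, TangentSpace I x} {x : M}
    (hY : MDiffAt (T% Y) x) (hZ : MDiffAt (T% Z) x) (v : TangentSpace I x) :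
    mvfderiv I (fun y ↦ inner ℝ (Y y) (Z y)) x v =
      inner ℝ (leviCivita Y x v) (Z x) + inner ℝ (Y x) (leviCivita Z x v) := by
  have h := isMetricCompatible_leviCivita (FiberBundle.mdifferentiableAt_extend I E v) hY hZ
  simpa only [FiberBundle.extend_apply_self] using h

lemma HasCovDerivAlong.hasDerivAt_inner {γ : ℝ → M} {V : Π t : ℝ, TangentSpace I (γ t)} {t : ℝ}
    {W : TangentSpace I (γ t)} (h : HasCovDerivAlong I γ V t W) {Z : Π x : M, TangentSpace I x}
    (hZ : MDiffAt (T% Z) (γ t)) :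
    HasDerivAt (fun s ↦ (inner ℝ (V s) (Z (γ s)) : ℝ))
      (inner ℝ W (Z (γ t)) + inner ℝ (V t) (leviCivita Z (γ t) (velocity I γ t))) t := by
  obtain ⟨hγ, n, f, f', X, hf, hX, hV, hW⟩ := h
  have h1 : ∀ i, HasDerivAt (fun s ↦ f i s * (inner ℝ (X i (γ s)) (Z (γ s)) : ℝ))
      (f' i * inner ℝ (X i (γ t)) (Z (γ t)) +
        f i t * (inner ℝ (leviCivita (X i) (γ t) (velocity I γ t)) (Z (γ t)) +
          inner ℝ (X i (γ t)) (leviCivita Z (γ t) (velocity I γ t)))) t := fun i ↦ by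
    rw [← mvfderiv_inner (hX i) hZ]
    exact (hf i).mul (hasDerivAt_comp_curve (mdifferentiableAt_inner (hX i) hZ) hγ)
  have h2 := HasDerivAt.fun_sum fun i (_ : i ∈ Finset.univ) ↦ h1 i
  have h3 : (fun s ↦ (inner ℝ (V s) (Z (γ s)) : ℝ)) =ᶠ[𝓝 t]
      fun s ↦ ∑ i, f i s * (inner ℝ (X i (γ s)) (Z (γ s)) : ℝ) := by
    filter_upwards [hV] with s hs
    simp only [hs, sum_inner, real_inner_smul_left]
  refine (h2.congr_of_eventuallyEq h3).congr_deriv ?_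
  rw [hW, hV.self_of_nhds]
  simp only [sum_inner, inner_add_left, real_inner_smul_left, ← Finset.sum_add_distrib]
  exact Finset.sum_congr rfl fun i _ ↦ by ring

lemma leviCivita_sub_leviCivita {X Y : Π x : M, TangentSpace I x} {x : M}
    (hX : MDiffAt (T% X) x) (hY : MDiffAt (T% Y) x) :
    leviCivita Y x (X x) - leviCivita X x (Y x) = mlieBracket I X Y x :=
  (CovariantDerivative.torsion_eq_zero_iff _).1 torsion_leviCivita hX hY

end AlongCurves

section LeftInvariantMetric

attribute [local instance] lieGroup_minSmoothness

variable {E : Type*} [NormedAddCommGroup E] [NormedSpace ℝ E]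
  {G : Type*} [TopologicalSpace G] [ChartedSpace E G] [Group G] [LieGroup 𝓘(ℝ, E) ∞ G]
  [RiemannianBundle (fun x : G ↦ TangentSpace 𝓘(ℝ, E) x)]

omit [RiemannianBundle (fun x : G ↦ TangentSpace 𝓘(ℝ, E) x)] in
lemma mdifferentiableAt_leftInvariant (v : TangentSpace 𝓘(ℝ, E) (1 : G)) (g : G) :
    MDiffAt (T% (mulInvariantVectorField v : Π g : G, TangentSpace 𝓘(ℝ, E) g)) g :=
  mdifferentiableAt_mulInvariantVectorField v

omit [LieGroup 𝓘(ℝ, E) ∞ G] in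
lemma inner_mulInvariantVectorField (hinv : IsLeftInvariantMetric 𝓘(ℝ, E) G) (g : G)
    (x y : TangentSpace 𝓘(ℝ, E) (1 : G)) :
    (inner ℝ (mulInvariantVectorField x g) (mulInvariantVectorField y g) : ℝ) = inner ℝ x y := by
  have key : ∀ h : G, g * 1 = h → ∀ a b : E,
      @inner ℝ (TangentSpace 𝓘(ℝ, E) (g * 1)) _ a b =
        @inner ℝ (TangentSpace 𝓘(ℝ, E) h) _ a b := by
    rintro _ rfl a b
    rfl
  exact (key g (mul_one g) _ _).symm.trans (hinv g 1 x y)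

variable [FiniteDimensional ℝ E]

omit [LieGroup 𝓘(ℝ, E) ∞ G] in
lemma exists_mulInvariantVectorField_eq (hinv : IsLeftInvariantMetric 𝓘(ℝ, E) G) (g : G)
    (v : TangentSpace 𝓘(ℝ, E) g) :
    ∃ x : TangentSpace 𝓘(ℝ, E) (1 : G), mulInvariantVectorField x g = v := by
  let A : E →ₗ[ℝ] E :=
    (mfderiv 𝓘(ℝ, E) 𝓘(ℝ, E) (fun x : G ↦ g * x) 1 : E →L[ℝ] E).toLinearMap
  have hA : Function.Injective A := by
    rw [← LinearMap.ker_eq_bot, LinearMap.ker_eq_bot']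
    intro x hx
    have h1 := inner_mulInvariantVectorField hinv g x x
    have h2 : mulInvariantVectorField (I := 𝓘(ℝ, E)) (x : TangentSpace 𝓘(ℝ, E) (1 : G)) g = 0 := hx
    rw [h2, inner_zero_left] at h1
    exact (inner_self_eq_zero (𝕜 := ℝ) (E := TangentSpace 𝓘(ℝ, E) (1 : G))).1 h1.symm
  exact LinearMap.injective_iff_surjective.1 hA v

omit [LieGroup 𝓘(ℝ, E) ∞ G] in
lemma ext_inner_mulInvariantVectorField (hinv : IsLeftInvariantMetric 𝓘(ℝ, E) G) {g : G}
    {v w : TangentSpace 𝓘(ℝ, E) g}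
    (h : ∀ z : TangentSpace 𝓘(ℝ, E) (1 : G), (inner ℝ v (mulInvariantVectorField z g) : ℝ) =
      inner ℝ w (mulInvariantVectorField z g)) : v = w := by
  refine ext_inner_right ℝ fun u ↦ ?_
  obtain ⟨z, rfl⟩ := exists_mulInvariantVectorField_eq hinv g u
  exact h z

omit [LieGroup 𝓘(ℝ, E) ∞ G] [FiniteDimensional ℝ E] in
lemma dInner_mulInvariantVectorField (hinv : IsLeftInvariantMetric 𝓘(ℝ, E) G)
    (x y : TangentSpace 𝓘(ℝ, E) (1 : G)) (g : G) :
    dInner (I := 𝓘(ℝ, E)) (mulInvariantVectorField x) (mulInvariantVectorField y) g = 0 := by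
  rw [dInner, funext fun h ↦ inner_mulInvariantVectorField hinv h x y]
  exact mvfderiv_const _

omit [RiemannianBundle (fun x : G ↦ TangentSpace 𝓘(ℝ, E) x)] in
lemma mlieBracket_mulInvariantVectorField (x y : TangentSpace 𝓘(ℝ, E) (1 : G)) (g : G) :
    mlieBracket 𝓘(ℝ, E) (mulInvariantVectorField x) (mulInvariantVectorField y) g =
      mulInvariantVectorField ⁅x, y⁆ g := by
  have := FiniteDimensional.complete ℝ E
  rw [GroupLieAlgebra.bracket_def, mulInvariantVector_mlieBracket]

lemma koszul_mulInvariantVectorField (hinv : IsLeftInvariantMetric 𝓘(ℝ, E) G)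
    (x y z : TangentSpace 𝓘(ℝ, E) (1 : G)) (g : G) :
    koszul (I := 𝓘(ℝ, E)) (mulInvariantVectorField x) (mulInvariantVectorField y)
      (mulInvariantVectorField z) g =
      inner ℝ ⁅x, y⁆ z - inner ℝ ⁅y, z⁆ x - inner ℝ ⁅x, z⁆ y := by
  simp only [koszul, dInner_mulInvariantVectorField hinv, mlieBracket_mulInvariantVectorField,
    inner_mulInvariantVectorField hinv]
  simp

variable [IsContMDiffRiemannianBundle 𝓘(ℝ, E) ∞ E (fun x : G ↦ TangentSpace 𝓘(ℝ, E) x)]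

variable (E G) in
/-- The Levi-Civita connection of left-invariant vector fields, at the identity. -/
def leftInvariantConnection :
    TangentSpace 𝓘(ℝ, E) (1 : G) →ₗ[ℝ]
      TangentSpace 𝓘(ℝ, E) (1 : G) →ₗ[ℝ] TangentSpace 𝓘(ℝ, E) (1 : G) :=
  LinearMap.mk₂ ℝ (fun x y ↦ leviCivita (mulInvariantVectorField y) (1 : G) x)
    (fun x x' y ↦ map_add _ _ _) (fun c x y ↦ map_smul _ _ _)
    (fun x y y' ↦ by
      rw [mulInvariantVectorField_add]
      exact congrArg (· x) (leviCivita.isCovariantDerivativeOnUniv.add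
        (mdifferentiableAt_leftInvariant y 1) (mdifferentiableAt_leftInvariant y' 1)))
    (fun c x y ↦ by
      rw [mulInvariantVectorField_smul]
      exact congrArg (· x) (leviCivita.isCovariantDerivativeOnUniv.smul_const c
        (mdifferentiableAt_leftInvariant y 1)))

lemma leviCivita_mulInvariantVectorField (hinv : IsLeftInvariantMetric 𝓘(ℝ, E) G)
    (x y : TangentSpace 𝓘(ℝ, E) (1 : G)) (g : G) :
    leviCivita (mulInvariantVectorField y) g (mulInvariantVectorField x g) =
      mulInvariantVectorField (leftInvariantConnection E G x y) g := by
  refine ext_inner_mulInvariantVectorField hinv fun z ↦ ?_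
  rw [inner_mulInvariantVectorField hinv,
    inner_leviCivita (mdifferentiableAt_leftInvariant x g) (mdifferentiableAt_leftInvariant y g)
      (mdifferentiableAt_leftInvariant z g), koszul_mulInvariantVectorField hinv,
    ← koszul_mulInvariantVectorField hinv x y z 1,
    ← inner_leviCivita (mdifferentiableAt_leftInvariant x 1) (mdifferentiableAt_leftInvariant y 1)
      (mdifferentiableAt_leftInvariant z 1), mulInvariantVectorField_one,
    mulInvariantVectorField_one]
  rfl

lemma leftInvariantConnection_skew (hinv : IsLeftInvariantMetric 𝓘(ℝ, E) G)
    (x y z : TangentSpace 𝓘(ℝ, E) (1 : G)) :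
    (inner ℝ (leftInvariantConnection E G x y) z : ℝ) =
      - inner ℝ y (leftInvariantConnection E G x z) := by
  have h := mvfderiv_inner (mdifferentiableAt_leftInvariant y (1 : G))
    (mdifferentiableAt_leftInvariant z 1) (mulInvariantVectorField x 1)
  simp only [leviCivita_mulInvariantVectorField hinv, inner_mulInvariantVectorField hinv] at h
  rw [mvfderiv_const, zero_apply] at h
  linarith

lemma leftInvariantConnection_sub (x y : TangentSpace 𝓘(ℝ, E) (1 : G)) :
    leftInvariantConnection E G x y - leftInvariantConnection E G y x = ⁅x, y⁆ := by
  have h := leviCivita_sub_leviCivita (mdifferentiableAt_leftInvariant x (1 : G))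
    (mdifferentiableAt_leftInvariant y 1)
  rw [mlieBracket_mulInvariantVectorField] at h
  simp only [mulInvariantVectorField_one] at h
  exact h

lemma curvature_mulInvariantVectorField_one (hinv : IsLeftInvariantMetric 𝓘(ℝ, E) G)
    (x y z : TangentSpace 𝓘(ℝ, E) (1 : G)) :
    curvature 𝓘(ℝ, E) (mulInvariantVectorField x) (mulInvariantVectorField y)
      (mulInvariantVectorField z) (1 : G) =
      algebraicCurvature (leftInvariantConnection E G) x y z := by
  have h1 : ∀ a b : TangentSpace 𝓘(ℝ, E) (1 : G),
      (fun g : G ↦ leviCivita (mulInvariantVectorField b) g (mulInvariantVectorField a g)) =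
        mulInvariantVectorField (leftInvariantConnection E G a b) := fun a b ↦
    funext fun g ↦ leviCivita_mulInvariantVectorField hinv a b g
  rw [curvature, h1, h1, mlieBracket_mulInvariantVectorField]
  simp only [mulInvariantVectorField_one]
  rw [algebraicCurvature, leftInvariantConnection_sub]
  rfl

lemma mvfderiv_inner_mulRightInvariantVectorField (hinv : IsLeftInvariantMetric 𝓘(ℝ, E) G)
    {g : G} {k y : TangentSpace 𝓘(ℝ, E) (1 : G)}
    (hy : mulInvariantVectorField y g = mulRightInvariantVectorField k g)
    (u z : TangentSpace 𝓘(ℝ, E) (1 : G)) :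
    mvfderiv 𝓘(ℝ, E) (fun h : G ↦
        (inner ℝ (mulRightInvariantVectorField k h) (mulInvariantVectorField z h) : ℝ)) g
      (mulInvariantVectorField u g) =
      inner ℝ (leftInvariantConnection E G y u) z +
        inner ℝ y (leftInvariantConnection E G u z) := by
  have := FiniteDimensional.complete ℝ E
  have hk := mdifferentiableAt_mulRightInvariantVectorField k g
  have h1 := leviCivita_sub_leviCivita hk (mdifferentiableAt_leftInvariant u g)
  rw [mlieBracket_mulRightInvariantVectorField, ← hy, leviCivita_mulInvariantVectorField hinv,
    sub_eq_zero] at h1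
  rw [mvfderiv_inner hk (mdifferentiableAt_leftInvariant z g), ← h1, ← hy]
  simp only [leviCivita_mulInvariantVectorField hinv, inner_mulInvariantVectorField hinv]

/-- If a geodesic starting at the identity returns to the identity, the Killing fields given by
right-invariant vector fields are infinitesimally nonincreasing in norm at its start, provided the
curvature is nonpositive. -/
lemma inner_leftInvariantConnection_le_zero (hinv : IsLeftInvariantMetric 𝓘(ℝ, E) G)
    (hcurv : ∀ x y, (inner ℝ (algebraicCurvature (leftInvariantConnection E G) x y y) x : ℝ) ≤ 0)
    {w : TangentSpace 𝓘(ℝ, E) (1 : G)} (hw : IsClosedDirection 𝓘(ℝ, E) (1 : G) w)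
    (k : TangentSpace 𝓘(ℝ, E) (1 : G)) :
    (inner ℝ (leftInvariantConnection E G k w) k : ℝ) ≤ 0 := by
  obtain ⟨γ, s, τ, hτ, -, hs, ⟨-, hgeo⟩, h0, hend⟩ := hw
  choose u hu using fun t ↦ exists_mulInvariantVectorField_eq hinv (γ t) (velocity 𝓘(ℝ, E) γ t)
  choose y hy using fun t ↦
    exists_mulInvariantVectorField_eq hinv (γ t) (mulRightInvariantVectorField k (γ t))
  have hu0 : u 0 = w := by
    have key : ∀ p : TangentBundle 𝓘(ℝ, E) G, p = ⟨1, w⟩ →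
        ∀ x, mulInvariantVectorField x p.proj = p.snd → x = w := by
      rintro _ rfl x hx
      rwa [mulInvariantVectorField_one] at hx
    exact key _ h0 _ (hu 0)
  have hγ0 : γ 0 = 1 := congrArg TotalSpace.proj h0
  have hy1 : ∀ g : G, g = 1 → ∀ x, mulInvariantVectorField x g = mulRightInvariantVectorField k g →
      x = k := by
    rintro _ rfl x hx
    rwa [mulInvariantVectorField_one, mulRightInvariantVectorField_one] at hx
  have hy0 := hy1 _ hγ0 _ (hy 0)
  have hyτ := hy1 _ hend _ (hy τ)
  have := inner_le_zero_of_convex (leftInvariantConnection_skew hinv) hcurv (u := u) (y := y) hτ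
    (fun t ht z ↦ ?_) (fun t ht z ↦ ?_) (by rw [hy0, hyτ])
  · rwa [hu0, hy0] at this
  · have h1 := (hgeo t (hs ht)).hasDerivAt_inner (mdifferentiableAt_leftInvariant z (γ t))
    simp only [inner_zero_left, zero_add, ← hu, leviCivita_mulInvariantVectorField hinv,
      inner_mulInvariantVectorField hinv] at h1
    exact h1
  · have h1 := hasDerivAt_comp_curve (mdifferentiableAt_inner
      (mdifferentiableAt_mulRightInvariantVectorField k (γ t))
      (mdifferentiableAt_leftInvariant z (γ t))) (hgeo t (hs ht)).1
    rw [← hu, mvfderiv_inner_mulRightInvariantVectorField hinv (hy t)] at h1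
    simp only [← hy, inner_mulInvariantVectorField hinv] at h1
    exact h1

/-- Dense closed geodesics and nonpositive sectional curvature force left-invariant vector fields
to be parallel. -/
theorem leftInvariantConnection_eq_zero (hinv : IsLeftInvariantMetric 𝓘(ℝ, E) G)
    (hdense : HasDenseClosedGeodesics 𝓘(ℝ, E) G)
    (hsec : ∀ u v : TangentSpace 𝓘(ℝ, E) (1 : G), LinearIndependent ℝ ![u, v] →
      sectionalCurvatureAtOne 𝓘(ℝ, E) u v ≤ 0) :
    leftInvariantConnection E G = 0 := by
  have hcurv : ∀ x y : TangentSpace 𝓘(ℝ, E) (1 : G),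
      (inner ℝ (algebraicCurvature (leftInvariantConnection E G) x y y) x : ℝ) ≤ 0 := by
    refine inner_algebraicCurvature_le_zero (leftInvariantConnection_skew hinv) fun x y hxy ↦ ?_
    have h1 := hsec x y hxy
    rw [sectionalCurvatureAtOne, sectionalCurvature, curvature_mulInvariantVectorField_one hinv,
      mulInvariantVectorField_one, mulInvariantVectorField_one] at h1
    have h2 : 0 < ‖x‖ ^ 2 * ‖y‖ ^ 2 - (inner ℝ x y : ℝ) ^ 2 := by
      have h3 : |(inner ℝ x y : ℝ)| < ‖x‖ * ‖y‖ := by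
        refine lt_of_le_of_ne (abs_real_inner_le_norm x y) fun h ↦ ?_
        have hx : x ≠ 0 := hxy.ne_zero 0
        have hy : y ≠ 0 := hxy.ne_zero 1
        obtain ⟨-, r, hr, hr'⟩ := (abs_real_inner_div_norm_mul_norm_eq_one_iff x y).1 (by
          rw [abs_div, h, abs_of_nonneg (by positivity)]
          exact div_self (by simp [hx, hy]))
        have := LinearIndependent.pair_iff.1 hxy r (-1) (by simp [hr'])
        simp at this
      have h4 := sq_lt_sq' (by linarith [neg_abs_le (inner ℝ x y : ℝ)])
        ((le_abs_self _).trans_lt h3)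
      rw [mul_pow] at h4
      linarith
    exact (div_nonpos_iff.1 h1).elim (fun h ↦ absurd h.2 (not_le.2 h2)) (fun h ↦ h.1)
  refine eq_zero_of_dense (leftInvariantConnection_skew hinv) hcurv fun v hv ε hε ↦ ?_
  obtain ⟨w, hw, hw'⟩ := hdense 1 v hv ε hε
  exact ⟨w, hw, inner_leftInvariantConnection_le_zero hinv hcurv hw'⟩

end LeftInvariantMetric

section LocallyConstant

variable {E : Type*} [NormedAddCommGroup E] [NormedSpace ℝ E]
  {M : Type*} [TopologicalSpace M] [ChartedSpace E M]
  {E' : Type*} [NormedAddCommGroup E'] [NormedSpace ℝ E']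
  {M' : Type*} [TopologicalSpace M'] [ChartedSpace E' M'] [IsManifold 𝓘(ℝ, E) 1 M]
  [IsManifold 𝓘(ℝ, E') 1 M']

lemma isLocallyConstant_of_mfderiv_eq_zero {f : M → M'} (hf : MDiff f)
    (hf' : ∀ x, mfderiv 𝓘(ℝ, E) 𝓘(ℝ, E') f x = 0) : IsLocallyConstant f := by
  refine (IsLocallyConstant.iff_eventually_eq f).2 fun x ↦ ?_
  set φ := extChartAt 𝓘(ℝ, E) x
  set φ' := extChartAt 𝓘(ℝ, E') (f x)
  have hc : ContinuousAt (fun a ↦ f (φ.symm a)) (φ x) :=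
    ContinuousAt.comp (g := f) hf.continuous.continuousAt (continuousAt_extChartAt_symm x)
  have hx : φ.symm (φ x) = x := extChartAt_to_inv x
  have hs : {a | a ∈ φ.target ∧ f (φ.symm a) ∈ φ'.source} ∈ 𝓝 (φ x) := by
    refine Filter.inter_mem (extChartAt_target_mem_nhds x) (hc.preimage_mem_nhds ?_)
    change φ'.source ∈ 𝓝 (f (φ.symm (φ x)))
    rw [hx]
    exact extChartAt_source_mem_nhds (f x)
  obtain ⟨ε, hε, hball⟩ := Metric.mem_nhds_iff.1 hs
  have hd : ∀ a ∈ Metric.ball (φ x) ε,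
      HasFDerivAt (fun a ↦ φ' (f (φ.symm a))) (0 : E →L[ℝ] E') a := by
    intro a ha
    obtain ⟨ha1, ha2⟩ := hball ha
    have h1 : MDifferentiableAt 𝓘(ℝ, E) 𝓘(ℝ, E) φ.symm a := by
      have := mdifferentiableWithinAt_extChartAt_symm (I := 𝓘(ℝ, E)) ha1
      rwa [ModelWithCorners.range_eq_univ, mdifferentiableWithinAt_univ] at this
    have h2 : MDifferentiableAt 𝓘(ℝ, E') 𝓘(ℝ, E') φ' (f (φ.symm a)) :=
      mdifferentiableAt_extChartAt (by simpa [φ'] using ha2)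
    have h3 := (h2.hasMFDerivAt.comp _ (hf (φ.symm a)).hasMFDerivAt).comp a h1.hasMFDerivAt
    rw [hf'] at h3
    have h4 := hasMFDerivAt_iff_hasFDerivAt.1 h3
    refine h4.congr_fderiv ?_
    ext v
    exact map_zero (mfderiv 𝓘(ℝ, E') 𝓘(ℝ, E') φ' (f (φ.symm a)))
  have hconst : ∀ a ∈ Metric.ball (φ x) ε, φ' (f (φ.symm a)) = φ' (f (φ.symm (φ x))) := by
    intro a ha
    exact Metric.isOpen_ball.is_const_of_fderiv_eq_zero (𝕜 := ℝ)
      (convex_ball (φ x) ε).isPreconnected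
      (fun b hb ↦ (hd b hb).differentiableAt.differentiableWithinAt)
      (fun b hb ↦ (hd b hb).fderiv) ha (Metric.mem_ball_self hε)
  have hev : ∀ᶠ y in 𝓝 x, φ y ∈ Metric.ball (φ x) ε :=
    (continuousAt_extChartAt x) (Metric.ball_mem_nhds _ hε)
  filter_upwards [hev, extChartAt_source_mem_nhds (I := 𝓘(ℝ, E)) x] with y hy hy'
  have h1 := hconst _ hy
  have h2 := (hball hy).2
  rw [hx, φ.left_inv hy'] at h1
  rw [φ.left_inv hy'] at h2
  exact φ'.injOn h2 (mem_extChartAt_source (f x)) h1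

end LocallyConstant

section Commutativity

attribute [local instance] lieGroup_minSmoothness

variable {E : Type*} [NormedAddCommGroup E] [NormedSpace ℝ E]
  {G : Type*} [TopologicalSpace G] [ChartedSpace E G] [Group G] [LieGroup 𝓘(ℝ, E) ∞ G]

lemma mfderiv_eq_zero_of_mul_eq {P : G → G} (hP : MDiffAt P 1) (hmul : ∀ k, k * P k = P 1 * k)
    (h : ∀ v : TangentSpace 𝓘(ℝ, E) (1 : G),
      mulRightInvariantVectorField v (P 1) = mulInvariantVectorField v (P 1)) :
    mfderiv 𝓘(ℝ, E) 𝓘(ℝ, E) P 1 = 0 := by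
  ext v
  have h1 : MDifferentiableAt (𝓘(ℝ, E).prod 𝓘(ℝ, E)) 𝓘(ℝ, E) (fun p : G × G ↦ p.1 * p.2)
      ((1 : G), P 1) := (contMDiff_mul 𝓘(ℝ, E) ∞).mdifferentiable (by simp) _
  have h2 : HasMFDerivAt 𝓘(ℝ, E) (𝓘(ℝ, E).prod 𝓘(ℝ, E)) (fun k : G ↦ (k, P k)) 1
      ((ContinuousLinearMap.id ℝ (TangentSpace 𝓘(ℝ, E) (1 : G))).prod
        (mfderiv 𝓘(ℝ, E) 𝓘(ℝ, E) P 1)) :=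
    (hasMFDerivAt_id 1).prodMk hP.hasMFDerivAt
  have h3 := congrArg (fun A : E →L[ℝ] E ↦ A v) (h1.hasMFDerivAt.comp (1 : G) h2).mfderiv
  have h4 : ∀ m : G → G, m = (fun k ↦ P 1 * k) →
      (mfderiv 𝓘(ℝ, E) 𝓘(ℝ, E) m 1 v : E) = mulInvariantVectorField v (P 1) := by
    rintro _ rfl
    rfl
  have h5 : (mfderiv 𝓘(ℝ, E) 𝓘(ℝ, E) (fun k : G ↦ 1 * k) (P 1)
      (mfderiv 𝓘(ℝ, E) 𝓘(ℝ, E) P 1 v) : E) = mfderiv 𝓘(ℝ, E) 𝓘(ℝ, E) P 1 v :=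
    mfderiv_apply_of_eq_id (by ext; simp) _
  let w : TangentSpace (𝓘(ℝ, E).prod 𝓘(ℝ, E)) ((1 : G), P 1) :=
    ((v, mfderiv 𝓘(ℝ, E) 𝓘(ℝ, E) P 1 v) : E × E)
  have h6 := mfderiv_prod_eq_add_apply (v := w) h1
  have h7 := (h4 _ (funext hmul)).symm.trans (h3.trans h6)
  rw [← h v] at h7
  exact h5.symm.trans (left_eq_add.1 h7)

/-- If the left- and right-invariant vector fields agree on the identity component, then this
component is commutative. -/
theorem commute_of_mulRightInvariantVectorField_eq
    (h : ∀ g ∈ connectedComponent (1 : G), ∀ v : TangentSpace 𝓘(ℝ, E) (1 : G),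
      mulRightInvariantVectorField v g = mulInvariantVectorField v g)
    {x y : G} (hx : x ∈ connectedComponent (1 : G)) (hy : y ∈ connectedComponent (1 : G)) :
    x * y = y * x := by
  have : IsManifold 𝓘(ℝ, E) 1 G := IsManifold.of_le (n := ∞) (by norm_cast)
  have : IsTopologicalGroup G := topologicalGroup_of_lieGroup 𝓘(ℝ, E) ∞
  have hsm : ∀ a : G, MDiff (fun k : G ↦ k⁻¹ * a * k) := fun a ↦
    (((contMDiff_inv 𝓘(ℝ, E) ∞).mul contMDiff_const).mul contMDiff_id).mdifferentiable (by simp)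
  have hmem : ∀ k : G, k⁻¹ * x * k ∈ connectedComponent (1 : G) := fun k ↦ by
    have hcont : Continuous fun a : G ↦ k⁻¹ * a * k := by fun_prop
    have := hcont.image_connectedComponent_subset 1 (Set.mem_image_of_mem _ hx)
    simpa using this
  have hzero : ∀ a ∈ connectedComponent (1 : G),
      mfderiv 𝓘(ℝ, E) 𝓘(ℝ, E) (fun k : G ↦ k⁻¹ * a * k) 1 = 0 := fun a ha ↦
    mfderiv_eq_zero_of_mul_eq (hsm a 1) (fun k ↦ by group) (h _ (by simpa using ha))
  have hzero' : ∀ k, mfderiv 𝓘(ℝ, E) 𝓘(ℝ, E) (fun k : G ↦ k⁻¹ * x * k) k = 0 := by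
    intro k
    have e : (fun l : G ↦ l⁻¹ * x * l) = (fun l : G ↦ l⁻¹ * (k⁻¹ * x * k) * l) ∘
        (fun l : G ↦ k⁻¹ * l) := by
      ext l
      simp only [Function.comp_apply]
      group
    have hj : ∀ j : G, j = 1 →
        mfderiv 𝓘(ℝ, E) 𝓘(ℝ, E) (fun l : G ↦ l⁻¹ * (k⁻¹ * x * k) * l) j = 0 := by
      rintro _ rfl
      exact hzero _ (hmem k)
    have hcomp := mfderiv_comp k (hsm (k⁻¹ * x * k) (k⁻¹ * k))
      (((contMDiff_mul_left (n := ∞) (a := k⁻¹)).mdifferentiable (by simp)) k)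
    have hm : ∀ m : G → G, m = (fun l : G ↦ l⁻¹ * (k⁻¹ * x * k) * l) ∘ (fun l : G ↦ k⁻¹ * l) →
        mfderiv 𝓘(ℝ, E) 𝓘(ℝ, E) m k = 0 := by
      rintro _ rfl
      ext v
      exact (congrArg (fun A : E →L[ℝ] E ↦ A v) hcomp).trans
        (congrArg (fun A : E →L[ℝ] E ↦ A (mfderiv 𝓘(ℝ, E) 𝓘(ℝ, E) (fun l : G ↦ k⁻¹ * l) k v))
          (hj _ (inv_mul_cancel k)))
    exact hm _ e
  have hconst := (isLocallyConstant_of_mfderiv_eq_zero (hsm x) hzero').apply_eq_of_isPreconnected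
    isPreconnected_connectedComponent hy mem_connectedComponent
  simp only [inv_one, one_mul, mul_one] at hconst
  rw [mul_assoc, inv_mul_eq_iff_eq_mul] at hconst
  exact hconst

variable [FiniteDimensional ℝ E] [RiemannianBundle (fun x : G ↦ TangentSpace 𝓘(ℝ, E) x)]
  [IsContMDiffRiemannianBundle 𝓘(ℝ, E) ∞ E (fun x : G ↦ TangentSpace 𝓘(ℝ, E) x)]

lemma mulRightInvariantVectorField_eq (hinv : IsLeftInvariantMetric 𝓘(ℝ, E) G)
    (hN : leftInvariantConnection E G = 0) {g : G} (hg : g ∈ connectedComponent (1 : G))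
    (v : TangentSpace 𝓘(ℝ, E) (1 : G)) :
    mulRightInvariantVectorField v g = mulInvariantVectorField v g := by
  have : IsManifold 𝓘(ℝ, E) 1 G := IsManifold.of_le (n := ∞) (by norm_cast)
  refine ext_inner_mulInvariantVectorField hinv fun z ↦ ?_
  have hd : MDiff (fun h : G ↦
      (inner ℝ (mulRightInvariantVectorField v h) (mulInvariantVectorField z h) : ℝ)) := fun h ↦
    mdifferentiableAt_inner (mdifferentiableAt_mulRightInvariantVectorField v h)
      (mdifferentiableAt_leftInvariant z h)
  have hlc := isLocallyConstant_of_mfderiv_eq_zero hd fun h ↦ by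
    ext w
    obtain ⟨u, rfl⟩ := exists_mulInvariantVectorField_eq hinv h w
    obtain ⟨y, hy⟩ := exists_mulInvariantVectorField_eq hinv h (mulRightInvariantVectorField v h)
    have := mvfderiv_inner_mulRightInvariantVectorField hinv hy u z
    simp only [hN, LinearMap.zero_apply, inner_zero_left, inner_zero_right, add_zero] at this
    exact this
  rw [hlc.apply_eq_of_isPreconnected isPreconnected_connectedComponent hg mem_connectedComponent,
    mulRightInvariantVectorField_one, mulInvariantVectorField_one,
    inner_mulInvariantVectorField hinv]

end Commutativity

section Flatness

attribute [local instance] lieGroup_minSmoothness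

variable {E : Type*} [NormedAddCommGroup E] [NormedSpace ℝ E] [FiniteDimensional ℝ E]
  {G : Type*} [TopologicalSpace G] [ChartedSpace E G] [Group G] [LieGroup 𝓘(ℝ, E) ∞ G]
  [RiemannianBundle (fun x : G ↦ TangentSpace 𝓘(ℝ, E) x)]

omit [LieGroup 𝓘(ℝ, E) ∞ G] in
lemma eq_sum_inner_mulInvariantVectorField (hinv : IsLeftInvariantMetric 𝓘(ℝ, E) G) {g : G}
    (v : TangentSpace 𝓘(ℝ, E) g) {ι : Type*} [Fintype ι]
    (b : OrthonormalBasis ι ℝ (TangentSpace 𝓘(ℝ, E) (1 : G))) :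
    v = ∑ i, (inner ℝ v (mulInvariantVectorField (b i) g) : ℝ) •
      mulInvariantVectorField (b i) g := by
  obtain ⟨w, rfl⟩ := exists_mulInvariantVectorField_eq hinv g v
  refine ext_inner_mulInvariantVectorField hinv fun z ↦ ?_
  simp only [sum_inner, real_inner_smul_left, inner_mulInvariantVectorField hinv,
    b.sum_inner_mul_inner]

variable [IsContMDiffRiemannianBundle 𝓘(ℝ, E) ∞ E (fun x : G ↦ TangentSpace 𝓘(ℝ, E) x)]

lemma inner_leviCivita_mulInvariantVectorField (hinv : IsLeftInvariantMetric 𝓘(ℝ, E) G)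
    (hN : leftInvariantConnection E G = 0) {Z : Π x : G, TangentSpace 𝓘(ℝ, E) x} {g : G}
    (hZ : MDiffAt (T% Z) g) (v : TangentSpace 𝓘(ℝ, E) g) (z : TangentSpace 𝓘(ℝ, E) (1 : G)) :
    (inner ℝ (leviCivita Z g v) (mulInvariantVectorField z g) : ℝ) =
      mvfderiv 𝓘(ℝ, E) (fun h ↦ (inner ℝ (Z h) (mulInvariantVectorField z h) : ℝ)) g v := by
  have h0 : leviCivita (mulInvariantVectorField z) g v = 0 := by
    obtain ⟨u, rfl⟩ := exists_mulInvariantVectorField_eq hinv g v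
    rw [leviCivita_mulInvariantVectorField hinv, hN, LinearMap.zero_apply, LinearMap.zero_apply]
    exact map_zero (mfderiv 𝓘(ℝ, E) 𝓘(ℝ, E) (fun x : G ↦ g * x) 1)
  rw [mvfderiv_inner hZ (mdifferentiableAt_leftInvariant z g), h0, inner_zero_right, add_zero]

omit [FiniteDimensional ℝ E] in
lemma contMDiffAt_inner_mulInvariantVectorField {Z : Π x : G, TangentSpace 𝓘(ℝ, E) x}
    (hZ : CMDiff ∞ (T% Z)) (z : TangentSpace 𝓘(ℝ, E) (1 : G)) (g : G) :
    CMDiffAt 2 (fun h ↦ (inner ℝ (Z h) (mulInvariantVectorField z h) : ℝ)) g :=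
  ContMDiffAt.inner_bundle (IB := 𝓘(ℝ, E)) (F := E) (E := fun x : G ↦ TangentSpace 𝓘(ℝ, E) x)
    (b := fun y ↦ y) (v := Z) (w := mulInvariantVectorField z) ((hZ g).of_le (by norm_cast))
    (contMDiff_mulInvariantVectorField_two z g)

lemma mdifferentiableAt_leviCivita (hinv : IsLeftInvariantMetric 𝓘(ℝ, E) G)
    (hN : leftInvariantConnection E G = 0) {Y Z : Π x : G, TangentSpace 𝓘(ℝ, E) x}
    (hY : CMDiff ∞ (T% Y)) (hZ : CMDiff ∞ (T% Z)) (g : G) :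
    MDiffAt (T% (fun h ↦ leviCivita Z h (Y h))) g := by
  have := FiniteDimensional.complete ℝ E
  let b := stdOrthonormalBasis ℝ (TangentSpace 𝓘(ℝ, E) (1 : G))
  have h1 : ∀ h, leviCivita Z h (Y h) = ∑ i, (mvfderiv 𝓘(ℝ, E)
      (fun h ↦ (inner ℝ (Z h) (mulInvariantVectorField (b i) h) : ℝ)) h (Y h)) •
        mulInvariantVectorField (b i) h := fun h ↦ by
    conv_lhs => rw [eq_sum_inner_mulInvariantVectorField hinv (leviCivita Z h (Y h)) b]
    simp only [inner_leviCivita_mulInvariantVectorField hinv hN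
      (hZ.mdifferentiable (by simp) h)]
  simp only [h1]
  refine MDifferentiableAt.sum_section fun i _ ↦ ?_
  refine MDifferentiableAt.smul_section ?_ (mdifferentiableAt_leftInvariant (b i) g)
  exact mdifferentiableAt_mvfderiv_apply
    (contMDiffAt_inner_mulInvariantVectorField hZ (b i) g)
    (hY.mdifferentiable (by simp) g)

theorem isFlat_of_leftInvariantConnection_eq_zero (hinv : IsLeftInvariantMetric 𝓘(ℝ, E) G)
    (hN : leftInvariantConnection E G = 0) : IsFlat 𝓘(ℝ, E) G := by
  intro X Y Z hX hY hZ g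
  have := FiniteDimensional.complete ℝ E
  have hZd := hZ.mdifferentiable (by simp)
  refine ext_inner_mulInvariantVectorField hinv fun z ↦ ?_
  rw [curvature, inner_zero_left, inner_sub_left, inner_sub_left,
    inner_leviCivita_mulInvariantVectorField hinv hN (mdifferentiableAt_leviCivita hinv hN hY hZ g),
    inner_leviCivita_mulInvariantVectorField hinv hN (mdifferentiableAt_leviCivita hinv hN hX hZ g),
    inner_leviCivita_mulInvariantVectorField hinv hN (hZd g)]
  simp only [inner_leviCivita_mulInvariantVectorField hinv hN (hZd _)]
  rw [mvfderiv_mlieBracket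
    (contMDiffAt_inner_mulInvariantVectorField hZ z g)
    (hX.mdifferentiable (by simp) g) (hY.mdifferentiable (by simp) g), sub_self]

end Flatness

end RiemannianGeometry

end

open RiemannianGeometry in
theorem mainTheorem2
    {E : Type*} [NormedAddCommGroup E] [NormedSpace ℝ E] [FiniteDimensional ℝ E]
    {G : Type*} [TopologicalSpace G] [ChartedSpace E G] [Group G] [LieGroup 𝓘(ℝ, E) ∞ G]
    [RiemannianBundle (fun x : G ↦ TangentSpace 𝓘(ℝ, E) x)]
    [IsContMDiffRiemannianBundle 𝓘(ℝ, E) ∞ E (fun x : G ↦ TangentSpace 𝓘(ℝ, E) x)]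
    (hinv : IsLeftInvariantMetric 𝓘(ℝ, E) G)
    (hdense : HasDenseClosedGeodesics 𝓘(ℝ, E) G) :
    (∃ u v : GroupLieAlgebra 𝓘(ℝ, E) G,
      LinearIndependent ℝ ![u, v] ∧ 0 < sectionalCurvatureAtOne 𝓘(ℝ, E) u v) ∨
    ((∀ x ∈ connectedComponent (1 : G), ∀ y ∈ connectedComponent (1 : G), x * y = y * x) ∧
      (ConnectedSpace G → ∀ x y : G, x * y = y * x) ∧
      IsFlat 𝓘(ℝ, E) G) := by
  by_cases hpos : ∃ u v : GroupLieAlgebra 𝓘(ℝ, E) G,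
      LinearIndependent ℝ ![u, v] ∧ 0 < sectionalCurvatureAtOne 𝓘(ℝ, E) u v
  · exact Or.inl hpos
  push Not at hpos
  have hN := leftInvariantConnection_eq_zero hinv hdense hpos
  have hcomm : ∀ x ∈ connectedComponent (1 : G), ∀ y ∈ connectedComponent (1 : G),
      x * y = y * x := fun x hx y hy ↦
    commute_of_mulRightInvariantVectorField_eq
      (fun g hg v ↦ mulRightInvariantVectorField_eq hinv hN hg v) hx hy
  refine Or.inr ⟨hcomm, fun _ x y ↦ hcomm x ?_ y ?_,
    isFlat_of_leftInvariantConnection_eq_zero hinv hN⟩ <;>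
  simp [PreconnectedSpace.connectedComponent_eq_univ]
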